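/- All varieties are irreducible and defined over $\mathbb{C}$. Let $X$ be a normal affine algebraic variety with nontrivial algebraic actions of $H_1$ and $H_2$, where $H_1\simeq\mathbb{C}_+$ and $H_2\simeq\mathbb{C}_+$ or $H_2\simeq\mathbb{C}^*$, and let $\delta_1,\delta_2$ be the algebraic vector fields on $X$ (derivations of $\mathbb{C}[X]$) generated by these actions. Assume that either (i) $[\delta_1,\delta_2]=0$, in which case set $\Gamma=H_1\times H_2$; or (ii) $\delta_1$ and $\delta_2$ are both locally nilpotent and generate a Lie algebra isomorphic to $\mathfrak{sl}_2$ that integrates to an algebraic action of $SL_2(\mathbb{C})$ on $X$, in which case set $\Gamma=SL_2(\mathbb{C})$ and regard $H_i$ as the one-parameter subgroup of $\Gamma$ corresponding to $\delta_i$. Let $X'$ be a normal affine algebraic variety with an algebraic $\Gamma$-action whose generic orbits have dimension $\dim\Gamma$ (that is, $2$ in case (i) and $3$ in case (ii)), and let $p:X\to X'$ be a finite surjective $\Gamma$-equivariant morphism. Write $\mathbb{C}[X]^{H_i}$ and $\mathbb{C}[X']^{H_i}$ for the algebras of $H_i$-invariant regular functions, i.e. the algebras of regular functions of the categorical quotients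 $X/\!/H_i$ and $X'/\!/H_i$. If the linear span $\mathrm{Span}(\mathbb{C}[X]^{H_1}\cdot\mathbb{C}[X]^{H_2})$ of products contains a nonzero ideal of $\mathbb{C}[X]$, then $\mathrm{Span}(\mathbb{C}[X']^{H_1}\cdot\mathbb{C}[X']^{H_2})$ contains a nonzero ideal of $\mathbb{C}[X']$. -/

import Mathlib

/-!
Affine varieties over `ℂ` are given by their algebras of regular functions: a normal affine
variety is a finitely generated `ℂ`-algebra that is an integrally closed domain, its points are the
`ℂ`-algebra homomorphisms to `ℂ`, and a morphism `X → X'` is a `ℂ`-algebra homomorphism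
`ℂ[X'] → ℂ[X]`. Algebraic vector fields are `ℂ`-derivations of the algebra of regular functions.
-/

namespace AffineAction

section Groups

/-- The additive group `ℂ₊`, written multiplicatively. -/
abbrev Ga : Type := Multiplicative ℂ

/-- The multiplicative group `ℂ^*`. -/
abbrev Gm : Type := ℂˣ

/-- The group `SL₂(ℂ)`. -/
abbrev SL2 : Type := Matrix.SpecialLinearGroup (Fin 2) ℂ

/-- The Lie algebra `sl₂(ℂ)` of traceless matrices. -/
abbrev LieSL2 : Type := LieAlgebra.SpecialLinear.sl (Fin 2) ℂ

/-- The algebra `ℂ[G]` of regular functions on a group of complex points. -/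
class RegularFunctions (G : Type) where
  coordRing : Subalgebra ℂ (G → ℂ)

/-- `ℂ[ℂ₊] = ℂ[t]`. -/
instance : RegularFunctions Ga where
  coordRing := Algebra.adjoin ℂ {fun t : Ga => Multiplicative.toAdd t}

/-- `ℂ[ℂ^*] = ℂ[t, t⁻¹]`. -/
instance : RegularFunctions Gm where
  coordRing := Algebra.adjoin ℂ {fun t : Gm => (t : ℂ), fun t : Gm => ((t⁻¹ : Gm) : ℂ)}

/-- `ℂ[SL₂]` is generated by the four matrix entries. -/
instance : RegularFunctions SL2 where
  coordRing := Algebra.adjoin ℂ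
    (Set.range fun (ij : Fin 2 × Fin 2) (g : SL2) => (g : Matrix (Fin 2) (Fin 2) ℂ) ij.1 ij.2)

/-- `ℂ[G × H]` is generated by the functions pulled back from the two factors. -/
instance {G H : Type} [RegularFunctions G] [RegularFunctions H] : RegularFunctions (G × H) where
  coordRing := Algebra.adjoin ℂ
    ({u | ∃ r ∈ RegularFunctions.coordRing (G := G), u = fun g => r g.1} ∪
     {u | ∃ r ∈ RegularFunctions.coordRing (G := H), u = fun g => r g.2})

/-- A one-dimensional group `H` (here `ℂ₊` or `ℂ^*`) together with its exponential map
`ℂ → H`, along which the phase flow of the generating vector field runs. -/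
class OneDimGroup (H : Type) where
  expMap : ℂ → H

instance : OneDimGroup Ga where
  expMap t := Multiplicative.ofAdd t

noncomputable instance : OneDimGroup Gm where
  expMap t := Units.mk0 (Complex.exp t) (Complex.exp_ne_zero t)

/-- The one-parameter subgroup `{exp (t e) : t ∈ ℂ}` of `SL₂(ℂ)` with direction `e ∈ sl₂(ℂ)`. -/
def oneParam (e : LieSL2) : Subgroup SL2 where
  carrier := {g | ∃ t : ℂ, (g : Matrix (Fin 2) (Fin 2) ℂ) =
    NormedSpace.exp (t • (e : Matrix (Fin 2) (Fin 2) ℂ))}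
  one_mem' := ⟨0, by simp⟩
  mul_mem' := by
    rintro g h ⟨s, hs⟩ ⟨t, ht⟩
    refine ⟨s + t, ?_⟩
    rw [Matrix.SpecialLinearGroup.coe_mul, hs, ht, add_smul, Matrix.exp_add_of_commute]
    exact (Commute.refl _).smul_left s |>.smul_right t
  inv_mem' := by
    rintro g ⟨t, ht⟩
    refine ⟨-t, ?_⟩
    have h1 : (g : Matrix (Fin 2) (Fin 2) ℂ) * ((g⁻¹ : SL2) : Matrix (Fin 2) (Fin 2) ℂ) = 1 := by
      rw [← Matrix.SpecialLinearGroup.coe_mul]; simp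
    rw [neg_smul, Matrix.exp_neg, ← ht]
    exact (Matrix.inv_eq_right_inv h1).symm

end Groups

section Actions

variable {A : Type*} [CommRing A] [Algebra ℂ A]

/-- The points of the affine variety with algebra of regular functions `A`. -/
abbrev Pt (A : Type*) [CommRing A] [Algebra ℂ A] : Type _ := A →ₐ[ℂ] ℂ

/-- An algebraic action of `G` on the affine variety `X` with `A = ℂ[X]`, given as the action on
regular functions. Algebraicity says that `g ↦ g • f` lies in `ℂ[G] ⊗ A` for all `f ∈ A`, i.e. that
the action map `G × X → X` is a morphism. -/
structure AlgAction (G : Type) [Group G] [RegularFunctions G]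
    (A : Type*) [CommRing A] [Algebra ℂ A] where
  hom : G →* (A ≃ₐ[ℂ] A)
  algebraic : ∀ f : A, ∃ (n : ℕ) (r : Fin n → G → ℂ) (a : Fin n → A),
    (∀ i, r i ∈ RegularFunctions.coordRing (G := G)) ∧ ∀ g, hom g f = ∑ i, r i g • a i

/-- The algebra `A^H = ℂ[X // H]` of functions invariant under a subgroup `H` of `G`. -/
def invariants {G : Type} [Group G] [RegularFunctions G] (ρ : AlgAction G A) (H : Subgroup G) :
    Subalgebra ℂ A where
  carrier := {f | ∀ h ∈ H, ρ.hom h f = f}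
  mul_mem' := fun ha hb h hh => by rw [map_mul, ha h hh, hb h hh]
  add_mem' := fun ha hb h hh => by rw [map_add, ha h hh, hb h hh]
  algebraMap_mem' := fun c h _ => AlgEquiv.commutes (ρ.hom h) c

/-- The orbit of a point: `g` carries the point `x` to `x ∘ g⁻¹`. -/
def orbit {G : Type} [Group G] [RegularFunctions G] (ρ : AlgAction G A) (x : Pt A) :
    Set (Pt A) :=
  {y | ∃ g : G, y = x.comp (ρ.hom g⁻¹ : A →ₐ[ℂ] A)}

/-- The ideal of functions vanishing on a set of points. -/
def vanishing (Z : Set (Pt A)) : Ideal A := ⨅ y ∈ Z, RingHom.ker y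

/-- The dimension of (the Zariski closure of) a set of points. -/
noncomputable def dimension (Z : Set (Pt A)) : WithBot ℕ∞ := ringKrullDim (A ⧸ vanishing Z)

/-- The generic orbits, i.e. those of the points of some nonempty basic open set, have
dimension `d`. (For `A` a domain, finitely generated over `ℂ`, the set `f ≠ 0` is nonempty as soon
as `f ≠ 0` in `A`.) -/
def GenericOrbitDim {G : Type} [Group G] [RegularFunctions G] (ρ : AlgAction G A) (d : ℕ) : Prop :=
  ∃ f : A, f ≠ 0 ∧ ∀ x : Pt A, x f ≠ 0 → dimension (orbit ρ x) = d

/-- The vector field `δ` is generated by the action `ρ` of the one-dimensional group `H`: it is the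
velocity field at time `0` of the flow `t ↦ exp t`. -/
def Generates {H : Type} [Group H] [RegularFunctions H] [OneDimGroup H] (ρ : AlgAction H A)
    (δ : Derivation ℂ A A) : Prop :=
  ∀ (x : Pt A) (f : A),
    HasDerivAt (fun t : ℂ => x (ρ.hom (OneDimGroup.expMap t) f)) (x (δ f)) 0

/-- The vector field `δ` is the image of `e ∈ sl₂` under the differential of the action `ρ` of
`SL₂`: it is the velocity field of `ρ` along curves through `1` with tangent vector `e`. -/
def IsDifferentialAt (ρ : AlgAction SL2 A) (e : LieSL2) (δ : Derivation ℂ A A) : Prop :=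
  ∀ c : ℂ → SL2, c 0 = 1 →
    (∀ i j, HasDerivAt (fun t => (c t : Matrix (Fin 2) (Fin 2) ℂ) i j)
      ((e : Matrix (Fin 2) (Fin 2) ℂ) i j) 0) →
    ∀ (x : Pt A) (f : A), HasDerivAt (fun t => x (ρ.hom (c t) f)) (x (δ f)) 0

/-- The derivation `δ` is locally nilpotent. -/
def LocallyNilpotent (δ : Derivation ℂ A A) : Prop := ∀ f : A, ∃ n : ℕ, (⇑δ)^[n] f = 0

/-- `Span (B₁ · B₂)` contains a nonzero ideal of `A`. -/
def IdealCondition (B₁ B₂ : Subalgebra ℂ A) : Prop :=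
  ∃ I : Ideal A, I ≠ ⊥ ∧
    ∀ f ∈ I, f ∈ Submodule.span ℂ {z : A | ∃ a ∈ B₁, ∃ b ∈ B₂, z = a * b}

end Actions


end AffineAction

/-! Write `K` and `k` for the fraction fields of `A` and `A'`, `Bᵢ` for the invariants of `Hᵢ` in
`A`, `Bᵢ'` for those in `A'`, and `S` for the algebra generated by `B₁'` and `B₂'`, which is the
span of products.

Descent (`idealCondition_comap`). By equivariance and normality the minimal polynomial over `A'` of
an invariant function has invariant coefficients, so traces of elements of `Bᵢ` lie in `Bᵢ'`. A dual
basis for the trace form then expresses all of `Bᵢ` through finitely many fixed elements of `K` with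
coefficients in `Bᵢ'` (`exists_finite_dual_family`). Hence elements of an ideal `I` inside the span
of `B₁ · B₂` are combinations of finitely many fixed elements of `K` with coefficients in `S`. A
`k`-linear retraction `K → k` applied to multiples of some nonzero `s ∈ I ∩ A'` gives `d s A' ⊆ S`,
provided a common denominator `d` can be taken in `S`. So it remains to see that `Frac S = k`.

Commuting case (`idealCondition_of_commuting`). Let `D` be the locally nilpotent derivation of the
`ℂ₊`-action on `A'`. If `D` does not vanish on `B₂'`, then `B₂'` contains a local slice `t`, and
`A'` becomes `(ker D)[t]` after inverting `D t`. If it does vanish, integrality gives `B₂ ⊆ B₁`, so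
`B₁` contains a nonzero ideal and `H₁` acts trivially, a contradiction.

Case of `SL₂` (`fractionClosure_eq_top_of_slTriple`). Three-dimensional generic orbits make the
fields `E`, `F`, `H` of an `sl₂`-triple independent over `A'`. Then `ker F` contains `P`, `Q` of
equal weight with `r = P / Q` not killed by `E`, and `β = E r = w / Q²` with `w ∈ ker F`. Both `r`
and `β` lie in `L = Frac S`. Since `k` has transcendence degree one over the constants of `E` in
`L`, `β` is algebraic over these constants with `r` adjoined, which forces `E β ∈ L`. Its numerator
`z = Q E w - 2 w E Q` satisfies `F z = -2 w Q`, so it is a local slice of `F`, and `ker F` together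
with `z` generates `k`. -/

namespace AffineAction

/-! ### Descent along a finite extension by traces -/

/-- A subring of a finite extension of characteristic zero whose elements have traces in `R` is
contained in a finitely generated `R`-module. -/
theorem exists_finite_dual_family {k K : Type*} [Field k] [Field K] [Algebra k K] [CharZero k]
    [FiniteDimensional k K] (B : Subring K) (R : Subring k)
    (h : ∀ b ∈ B, (minpoly k b).nextCoeff ∈ R) :
    ∃ (n : ℕ) (e : Fin n → K), ∀ b ∈ B, ∃ c : Fin n → k, (∀ i, c i ∈ R) ∧ b = ∑ i, c i • e i := by
  classical
  -- `B` need not span `K`, so the trace form is taken on `k(B)`, which `B` spans over `k`. A basis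
  -- can then be chosen inside `B`.
  let V : IntermediateField k K := IntermediateField.adjoin k (B : Set K)
  have hV : Subalgebra.toSubmodule V.toSubalgebra = Submodule.span k (B : Set K) := by
    rw [IntermediateField.adjoin_toSubalgebra_of_isAlgebraic
      (fun x _ => Algebra.IsAlgebraic.isAlgebraic x), Algebra.adjoin_eq_span]
    congr 1
    exact congrArg (fun M : Submonoid K => (M : Set K)) (Submonoid.closure_eq B.toSubmonoid)
  have hBV : ∀ b ∈ B, b ∈ V := fun b hb => IntermediateField.subset_adjoin k _ hb
  let s : Set V := {v | (v : K) ∈ B}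
  have hs : ⊤ ≤ Submodule.span k s := by
    intro v _
    have hv : (v : K) ∈ Submodule.span k (B : Set K) := by
      rw [← hV]; exact v.2
    have : Submodule.map V.val.toLinearMap (Submodule.span k s) = Submodule.span k (B : Set K) := by
      rw [Submodule.map_span]
      congr 1
      ext x
      constructor
      · rintro ⟨y, hy, rfl⟩; exact hy
      · intro hx; exact ⟨⟨x, hBV x hx⟩, hx, rfl⟩
    rw [← this] at hv
    obtain ⟨w, hw, hwv⟩ := hv
    have : w = v := Subtype.ext hwv
    exact this ▸ hw
  let b := Module.Basis.ofSpan hs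
  have hb : ∀ i, ((b i : V) : K) ∈ B := fun i => Module.Basis.ofSpan_subset hs ⟨i, rfl⟩
  have : Finite _ := Module.Finite.finite_basis b
  have := Fintype.ofFinite
    ((linearIndepOn_empty k (id : V → V)).extend (Set.empty_subset s))
  let nd := traceForm_nondegenerate k V
  let e := (Algebra.traceForm k V).dualBasis nd b
  have htr : ∀ y : V, (y : K) ∈ B → Algebra.trace k V y ∈ R := by
    intro y hy
    rw [trace_eq_finrank_mul_minpoly_nextCoeff]
    refine R.mul_mem (natCast_mem R _) (R.neg_mem ?_)
    have := h y hy
    rwa [show (y : K) = algebraMap V K y from rfl,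
      minpoly.algebraMap_eq (algebraMap V K).injective] at this
  -- The coordinate of `x` along a dual basis vector is the trace of `x` times a basis vector from
  -- `B`, that is, of an element of `B`.
  refine ⟨_, fun i => (e ((Fintype.equivFin _).symm i) : K), fun x hx => ?_⟩
  refine ⟨fun i => Algebra.trace k V (⟨x, hBV x hx⟩ * b ((Fintype.equivFin _).symm i)), ?_, ?_⟩
  · intro i
    exact htr _ (B.mul_mem hx (hb _))
  · have key := e.sum_repr ⟨x, hBV x hx⟩
    have h2 := congrArg (algebraMap V K) key
    rw [map_sum, ← (Fintype.equivFin _).symm.sum_comp] at h2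
    refine h2.symm.trans (Finset.sum_congr rfl fun i _ => ?_)
    rw [LinearMap.BilinForm.dualBasis_repr_apply, Algebra.traceForm_apply, Algebra.smul_def,
      map_mul, Algebra.smul_def]
    rfl

theorem idealCondition_iff {A : Type*} [CommRing A] [Algebra ℂ A] (B₁ B₂ : Subalgebra ℂ A) :
    IdealCondition B₁ B₂ ↔ ∃ I : Ideal A, I ≠ ⊥ ∧ ∀ f ∈ I, f ∈ B₁ ⊔ B₂ := by
  have : Submodule.span ℂ {z : A | ∃ a ∈ B₁, ∃ b ∈ B₂, z = a * b} =
      Subalgebra.toSubmodule (B₁ ⊔ B₂) := by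
    rw [← Subalgebra.mul_toSubmodule, Submodule.mul_eq_span_mul_set]
    congr 1
    ext z
    simp only [Set.mem_ofPred_eq, Set.mem_mul, SetLike.mem_coe, Subalgebra.mem_toSubmodule, eq_comm]
  unfold IdealCondition
  rw [this]
  rfl

/-- Finitely many fractions of a domain `A` can be cleared by a denominator from a subalgebra `S`
with the same field of fractions. -/
theorem exists_common_denominator {A K : Type*} [CommRing A] [IsDomain A] [Algebra ℂ A] [Field K]
    [Algebra A K] [IsFractionRing A K] (S : Subalgebra ℂ A)
    (hS : ∀ a : A, ∃ d ∈ S, d ≠ 0 ∧ d * a ∈ S) {ι : Type*} (s : Finset ι) (y : ι → K) :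
    ∃ d ∈ S, d ≠ 0 ∧ ∀ i ∈ s, ∃ u ∈ S, algebraMap A K d * y i = algebraMap A K u := by
  classical
  induction s using Finset.induction_on with
  | empty => exact ⟨1, S.one_mem, one_ne_zero, by simp⟩
  | insert i s hi ih =>
    obtain ⟨d, hd, hd0, h⟩ := ih
    obtain ⟨x, z, hz, hxz⟩ := IsFractionRing.div_surjective (A := A) (y i)
    have hz0 : z ≠ 0 := nonZeroDivisors.ne_zero hz
    obtain ⟨d₁, hd₁, hd₁0, h₁⟩ := hS x
    obtain ⟨d₂, hd₂, hd₂0, h₂⟩ := hS z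
    refine ⟨d * (d₁ * (d₂ * z)), S.mul_mem hd (S.mul_mem hd₁ h₂),
      mul_ne_zero hd0 (mul_ne_zero hd₁0 (mul_ne_zero hd₂0 hz0)), fun j hj => ?_⟩
    have hz' : algebraMap A K z ≠ 0 := by
      simpa using hz0
    rcases Finset.mem_insert.1 hj with rfl | hj
    · refine ⟨d * d₂ * (d₁ * x), S.mul_mem (S.mul_mem hd hd₂) h₁, ?_⟩
      rw [← hxz]
      simp only [map_mul]
      field_simp
    · obtain ⟨u, hu, hu'⟩ := h j hj
      refine ⟨u * (d₁ * (d₂ * z)), S.mul_mem hu (S.mul_mem hd₁ h₂), ?_⟩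
      rw [map_mul, map_mul _ u, ← hu']
      ring

/-- The hypotheses `h₁`, `h₂` stand for closure under traces, which puts the coordinates of the `Bᵢ`
in their contractions to `A'`; `hfrac` lets all remaining denominators be cleared inside the algebra
that the contractions generate. -/
theorem idealCondition_comap {A A' : Type*}
    [CommRing A] [Algebra ℂ A] [IsDomain A] [IsIntegrallyClosed A]
    [CommRing A'] [Algebra ℂ A'] [IsDomain A'] [IsIntegrallyClosed A']
    [Algebra A' A] [IsScalarTower ℂ A' A] [Module.Finite A' A] [FaithfulSMul A' A]
    (B₁ B₂ : Subalgebra ℂ A)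
    (h₁ : ∀ b ∈ B₁, algebraMap A' A (minpoly A' b).nextCoeff ∈ B₁)
    (h₂ : ∀ b ∈ B₂, algebraMap A' A (minpoly A' b).nextCoeff ∈ B₂)
    (hfrac : ∀ a : A', ∃ d ∈ B₁.comap (IsScalarTower.toAlgHom ℂ A' A) ⊔
        B₂.comap (IsScalarTower.toAlgHom ℂ A' A), d ≠ 0 ∧
      d * a ∈ B₁.comap (IsScalarTower.toAlgHom ℂ A' A) ⊔ B₂.comap (IsScalarTower.toAlgHom ℂ A' A))
    (hI : IdealCondition B₁ B₂) :
    IdealCondition (B₁.comap (IsScalarTower.toAlgHom ℂ A' A))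
      (B₂.comap (IsScalarTower.toAlgHom ℂ A' A)) := by
  classical
  rw [idealCondition_iff] at hI ⊢
  obtain ⟨I, hI0, hI⟩ := hI
  set S := B₁.comap (IsScalarTower.toAlgHom ℂ A' A) ⊔ B₂.comap (IsScalarTower.toAlgHom ℂ A' A)
    with hS
  obtain ⟨x, hxI, hx0⟩ := Submodule.exists_mem_ne_zero_of_ne_bot hI0
  have hc := Ideal.comap_ne_bot_of_integral_mem (R := A') hx0 hxI (Algebra.IsIntegral.isIntegral x)
  obtain ⟨s, hsI, hs0⟩ := Submodule.exists_mem_ne_zero_of_ne_bot hc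
  let k := FractionRing A'
  let K := FractionRing A
  let : Algebra k K := FractionRing.liftAlgebra A' K
  have : IsScalarTower A' k K := FractionRing.isScalarTower_liftAlgebra A' K
  have : CharZero A' := charZero_of_injective_algebraMap (algebraMap ℂ A').injective
  have : CharZero k := charZero_of_injective_algebraMap (IsFractionRing.injective A' k)
  have : Module.IsTorsionFree A' A := by
    rw [Module.isTorsionFree_iff_faithfulSMul]; infer_instance
  have : IsIntegralClosure A A' K := IsIntegralClosure.of_isIntegrallyClosed _ _ _
  have : Algebra.IsAlgebraic k K := isAlgebraic_of_isFractionRing A' A ..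
  have : IsLocalization (Algebra.algebraMapSubmonoid A (nonZeroDivisors A')) K :=
    IsIntegralClosure.isLocalization _ k _ _
  have : FiniteDimensional k K := .of_isLocalization A' A (nonZeroDivisors A')
  -- Normality of `A'` enters here: minimal polynomials over `k` already have coefficients in `A'`.
  have hmin : ∀ b : A, minpoly k (algebraMap A K b) = (minpoly A' b).map (algebraMap A' k) :=
    fun b => minpoly.isIntegrallyClosed_eq_field_fractions k K (Algebra.IsIntegral.isIntegral b)
  have dual : ∀ B : Subalgebra ℂ A, (∀ b ∈ B, algebraMap A' A (minpoly A' b).nextCoeff ∈ B) →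
      ∃ (n : ℕ) (e : Fin n → K), ∀ b ∈ B, ∃ c : Fin n → A',
        (∀ i, c i ∈ B.comap (IsScalarTower.toAlgHom ℂ A' A)) ∧
        algebraMap A K b = ∑ i, algebraMap A' k (c i) • e i := by
    intro B hB
    obtain ⟨n, e, h⟩ := exists_finite_dual_family (k := k) (B.toSubring.map (algebraMap A K))
      ((B.comap (IsScalarTower.toAlgHom ℂ A' A)).toSubring.map (algebraMap A' k)) (by
        rintro _ ⟨b, hb, rfl⟩
        refine ⟨(minpoly A' b).nextCoeff, hB b hb, ?_⟩
        rw [hmin, Polynomial.nextCoeff_map (IsFractionRing.injective A' k)])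
    refine ⟨n, e, fun b hb => ?_⟩
    obtain ⟨c, hc, hc'⟩ := h _ ⟨b, hb, rfl⟩
    choose c' hc1 hc2 using hc
    refine ⟨c', hc1, ?_⟩
    simpa only [hc2] using hc'
  obtain ⟨n₁, e₁, he₁⟩ := dual B₁ h₁
  obtain ⟨n₂, e₂, he₂⟩ := dual B₂ h₂
  have hsup : ∀ z ∈ B₁ ⊔ B₂, ∃ c : Fin n₁ × Fin n₂ → A', (∀ i, c i ∈ S) ∧
      algebraMap A K z = ∑ i, algebraMap A' k (c i) • (e₁ i.1 * e₂ i.2) := by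
    intro z hz
    rw [← Subalgebra.mem_toSubmodule, ← Subalgebra.mul_toSubmodule] at hz
    induction hz using Submodule.mul_induction_on' with
    | mem_mul_mem a ha b hb =>
      obtain ⟨c, hc, hc'⟩ := he₁ a ha
      obtain ⟨d, hd, hd'⟩ := he₂ b hb
      refine ⟨fun i => c i.1 * d i.2, fun i => S.mul_mem ((le_sup_left : _ ≤ S) (hc _))
        ((le_sup_right : _ ≤ S) (hd _)), ?_⟩
      rw [map_mul, hc', hd', Finset.sum_mul_sum, ← Finset.univ_product_univ, Finset.sum_product]
      refine Finset.sum_congr rfl fun i _ => Finset.sum_congr rfl fun j _ => ?_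
      rw [map_mul, smul_mul_smul_comm]
    | add a _ b _ ha hb =>
      obtain ⟨c, hc, hc'⟩ := ha
      obtain ⟨d, hd, hd'⟩ := hb
      refine ⟨fun i => c i + d i, fun i => S.add_mem (hc i) (hd i), ?_⟩
      rw [map_add, hc', hd', ← Finset.sum_add_distrib]
      simp only [map_add, add_smul]
  -- A `k`-linear retraction of `K` onto `k` replaces the products `e₁ i * e₂ j` by elements of `k`,
  -- whose denominators are then cleared by some `d ∈ S`.
  obtain ⟨r, hr⟩ := (Algebra.linearMap k K).exists_leftInverse_of_injective
    (LinearMap.ker_eq_bot.2 (algebraMap k K).injective)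
  have hr' : ∀ y : k, r (algebraMap k K y) = y := fun y => LinearMap.congr_fun hr y
  obtain ⟨d, hd, hd0, hdu⟩ := exists_common_denominator S hfrac Finset.univ
    fun i : Fin n₁ × Fin n₂ => r (e₁ i.1 * e₂ i.2)
  choose u hu hu' using fun i => hdu i (Finset.mem_univ i)
  refine ⟨Ideal.span {d * s}, ?_, ?_⟩
  · simp [hd0, hs0]
  · intro f hf
    obtain ⟨a, rfl⟩ := Ideal.mem_span_singleton'.1 hf
    have hsa : algebraMap A' A (s * a) ∈ I := by
      rw [map_mul]; exact I.mul_mem_right _ hsI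
    obtain ⟨c, hc, hc'⟩ := hsup _ (hI _ hsa)
    have h3 : algebraMap A' k (a * (d * s)) = algebraMap A' k (∑ i, c i * u i) := by
      have h4 := congrArg r hc'
      rw [← IsScalarTower.algebraMap_apply, IsScalarTower.algebraMap_apply A' k K, hr',
        map_sum] at h4
      have : a * (d * s) = d * (s * a) := by ring
      rw [this, map_mul _ d, h4, Finset.mul_sum, map_sum]
      refine Finset.sum_congr rfl fun i _ => ?_
      rw [map_mul (algebraMap A' k), ← hu' i, map_smul, smul_eq_mul]
      ring
    rw [IsFractionRing.injective A' k h3]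
    exact S.sum_mem fun i _ => S.mul_mem (hc i) (hu i)

/-! ### Points, and minimal polynomials under automorphisms -/

section UnivariatePolynomials

open Polynomial

/-- The Nullstellensatz: `A` is a Jacobson domain, so some maximal ideal misses `f`, and its residue
field is `ℂ`. -/
theorem exists_pt_ne_zero {A : Type*} [CommRing A] [Algebra ℂ A] [IsDomain A]
    [Algebra.FiniteType ℂ A] {f : A} (hf : f ≠ 0) : ∃ x : Pt A, x f ≠ 0 := by
  have : IsJacobsonRing A := isJacobsonRing_of_finiteType (A := ℂ)
  have hj : (⊥ : Ideal A).jacobson = ⊥ := IsJacobsonRing.out' _ Ideal.isRadical_bot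
  have hf' : f ∉ (⊥ : Ideal A).jacobson := by rw [hj]; simpa using hf
  rw [Ideal.jacobson, Submodule.mem_sInf] at hf'
  push Not at hf'
  obtain ⟨m, ⟨-, hm⟩, hfm⟩ := hf'
  let := Ideal.Quotient.field m
  have : Module.Finite ℂ (A ⧸ m) := finite_of_finite_type_of_isJacobsonRing ℂ (A ⧸ m)
  have hb : Function.Bijective (algebraMap ℂ (A ⧸ m)) :=
    IsAlgClosed.algebraMap_bijective_of_isIntegral
  let e := AlgEquiv.ofBijective (Algebra.ofId ℂ (A ⧸ m)) hb
  refine ⟨(e.symm : A ⧸ m →ₐ[ℂ] ℂ).comp (Ideal.Quotient.mkₐ ℂ m), fun h => hfm ?_⟩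
  have : e.symm (Ideal.Quotient.mk m f) = 0 := h
  rwa [EmbeddingLike.map_eq_zero_iff, Ideal.Quotient.eq_zero_iff_mem] at this

theorem eq_of_forall_pt {A : Type*} [CommRing A] [Algebra ℂ A] [IsDomain A]
    [Algebra.FiniteType ℂ A] {f g : A} (h : ∀ x : Pt A, x f = x g) : f = g := by
  by_contra hne
  obtain ⟨x, hx⟩ := exists_pt_ne_zero (sub_ne_zero.2 hne)
  exact hx (by rw [map_sub, h, sub_self])

/-- An automorphism compatible with an extension and fixing `b` fixes the minimal polynomial
of `b`. -/
theorem map_coeff_minpoly_of_fixed {A A' : Type*} [CommRing A] [IsDomain A] [Algebra ℂ A]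
    [CommRing A'] [IsDomain A'] [IsIntegrallyClosed A'] [Algebra ℂ A'] [Algebra A' A]
    [FaithfulSMul A' A] (τ : A ≃ₐ[ℂ] A) (τ' : A' ≃ₐ[ℂ] A')
    (h : ∀ a, τ (algebraMap A' A a) = algebraMap A' A (τ' a)) {b : A} (hb : IsIntegral A' b)
    (hfix : τ b = b) (n : ℕ) : τ' ((minpoly A' b).coeff n) = (minpoly A' b).coeff n := by
  have hcomp : (algebraMap A' A).comp (τ' : A' →+* A') = (τ : A →+* A).comp (algebraMap A' A) := by
    ext a; exact (h a).symm
  -- The transported polynomial is monic, kills `τ b = b` and has no larger degree, so uniqueness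
  -- over the normal ring `A'` applies.
  have key : (minpoly A' b).map (τ' : A' →+* A') = minpoly A' b := by
    refine minpoly.IsIntegrallyClosed.unique_of_degree_le_degree_minpoly
      ((minpoly.monic hb).map _) ?_ degree_map_le
    rw [Polynomial.aeval_def, Polynomial.eval₂_map, hcomp]
    have h2 := Polynomial.hom_eval₂ (minpoly A' b) (algebraMap A' A) (τ : A →+* A) b
    rw [← Polynomial.aeval_def, minpoly.aeval, map_zero, show (τ : A →+* A) b = b from hfix] at h2
    exact h2.symm
  conv_rhs => rw [← key, Polynomial.coeff_map]
  rfl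

/-! ### Locally nilpotent derivations and local slices -/

section Derivations

variable {A : Type*} [CommRing A] [Algebra ℂ A]

theorem derivation_iterate_mul_of_eq_zero (D : Derivation ℂ A A) {c : A} (hc : D c = 0) (n : ℕ)
    (x : A) : (⇑D)^[n] (c * x) = c * (⇑D)^[n] x := by
  induction n generalizing x with
  | zero => rfl
  | succ n ih => rw [Function.iterate_succ_apply, D.leibniz, hc, smul_zero, add_zero, smul_eq_mul, ih,
      Function.iterate_succ_apply]

theorem derivation_iterate_pow (D : Derivation ℂ A A) {t : A} (h : D (D t) = 0) (n : ℕ) :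
    (⇑D)^[n] (t ^ n) = n.factorial * (D t) ^ n := by
  induction n with
  | zero => simp
  | succ n ih =>
    have hc : D ((n + 1 : ℕ) * D t) = 0 := by rw [D.leibniz, h]; simp
    rw [Function.iterate_succ_apply, D.leibniz_pow, Nat.add_sub_cancel, nsmul_eq_mul, smul_eq_mul,
      show ((n + 1 : ℕ) : A) * (t ^ n * D t) = ((n + 1 : ℕ) * D t) * t ^ n by ring,
      derivation_iterate_mul_of_eq_zero D hc, ih, Nat.factorial_succ]
    push_cast
    ring

/-- A locally nilpotent derivation with local slice `t` has `A[1 / D t] = (ker D)[1 / D t][t]`. -/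
theorem exists_pow_mul_mem_of_slice (D : Derivation ℂ A A) (hD : LocallyNilpotent D)
    (S : Subalgebra ℂ A) (hS : ∀ a, D a = 0 → a ∈ S) {t : A} (ht : t ∈ S) (h : D (D t) = 0)
    (a : A) : ∃ N : ℕ, (D t) ^ N * a ∈ S := by
  obtain ⟨n, hn⟩ := hD a
  induction n generalizing a with
  | zero => exact ⟨0, by rw [show a = 0 from hn, mul_zero]; exact S.zero_mem⟩
  | succ n ih =>
    have hb : D ((⇑D)^[n] a) = 0 := by rwa [← Function.iterate_succ_apply' (⇑D)]
    have hg : ∀ k : ℕ, D (D t ^ k) = 0 := fun k => by rw [D.leibniz_pow, h]; simp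
    have hc : D ((n.factorial : A) * D t ^ n) = 0 := by rw [D.leibniz, hg]; simp
    -- Subtracting the top Taylor term in `t`, cleared of denominators, leaves an element killed by
    -- `D^[n]`.
    obtain ⟨N, hN⟩ := ih (n.factorial * D t ^ n * a - (⇑D)^[n] a * t ^ n) (by
      rw [iterate_map_sub, derivation_iterate_mul_of_eq_zero D hc,
        derivation_iterate_mul_of_eq_zero D hb, derivation_iterate_pow D h]
      ring)
    refine ⟨N + n, ?_⟩
    have hfac : (n.factorial : ℂ) ≠ 0 := by exact_mod_cast n.factorial_ne_zero
    have h1 : (n.factorial : A) * (D t ^ (N + n) * a) ∈ S := by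
      have := S.add_mem hN (S.mul_mem (S.mul_mem (hS _ (hg N)) (hS _ hb)) (S.pow_mem ht n))
      convert this using 1
      ring
    have h2 := S.smul_mem h1 (n.factorial : ℂ)⁻¹
    rwa [← nsmul_eq_mul, ← Nat.cast_smul_eq_nsmul ℂ, smul_smul, inv_mul_cancel₀ hfac, one_smul] at h2

theorem exists_slice (D : Derivation ℂ A A) (hD : LocallyNilpotent D) (B : Set A)
    (hB : ∀ b ∈ B, D b ∈ B) {b : A} (hb : b ∈ B) (hDb : D b ≠ 0) :
    ∃ t ∈ B, D t ≠ 0 ∧ D (D t) = 0 := by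
  classical
  have hex := hD b
  have hspec := Nat.find_spec hex
  have hit : ∀ k, (⇑D)^[k] b ∈ B := by
    intro k
    induction k with
    | zero => exact hb
    | succ k ih => rw [Function.iterate_succ_apply']; exact hB _ ih
  -- The order of nilpotency on `b` is at least two because `D b ≠ 0`; the slice is the iterate two
  -- steps before zero.
  obtain ⟨m, hm⟩ : ∃ m, Nat.find hex = m + 2 := by
    rcases h : Nat.find hex with _ | _ | m
    · rw [h] at hspec
      exact absurd (by rw [show b = 0 from hspec, map_zero]) hDb
    · rw [h] at hspec
      exact absurd hspec hDb
    · exact ⟨m, rfl⟩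
  refine ⟨_, hit m, ?_, ?_⟩
  · rw [← Function.iterate_succ_apply' (⇑D)]
    exact Nat.find_min hex (by omega)
  · rw [← Function.iterate_succ_apply' (⇑D), ← Function.iterate_succ_apply' (⇑D)]
    rw [hm] at hspec
    exact hspec

/-- A derivation preserving a subalgebra restricts to it. -/
theorem exists_derivation_restrict {A' : Type*} [CommRing A'] [Algebra ℂ A'] (p : A' →ₐ[ℂ] A)
    (hp : Function.Injective p) (D : Derivation ℂ A A) (h : ∀ a, ∃ b, D (p a) = p b) :
    ∃ D' : Derivation ℂ A' A', ∀ a, p (D' a) = D (p a) := by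
  choose d hd using h
  refine ⟨Derivation.mk' ⟨⟨d, fun a b => hp ?_⟩, fun c a => hp ?_⟩ fun a b => hp ?_, fun a => (hd a).symm⟩
  · rw [← hd]; simp only [map_add, hd]
  · rw [← hd]; simp only [map_smul, RingHom.id_apply, Derivation.map_smul, hd]
  · change p (d (a * b)) = p (a * d b + b * d a)
    rw [← hd, map_mul, D.leibniz, map_add, map_mul, map_mul, ← hd, ← hd]
    rfl

end Derivations

/-! ### Actions of the additive group and their generators -/

section Additive

variable {A : Type*} [CommRing A] [Algebra ℂ A]

theorem exists_polynomial_of_mem_coordRing_Ga {r : Ga → ℂ}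
    (hr : r ∈ RegularFunctions.coordRing (G := Ga)) :
    ∃ P : ℂ[X], ∀ t : ℂ, r (Multiplicative.ofAdd t) = P.eval t := by
  induction hr using Algebra.adjoin_induction with
  | mem x hx =>
    rw [Set.mem_singleton_iff] at hx
    exact ⟨X, fun t => by rw [hx]; simp⟩
  | algebraMap c => exact ⟨C c, fun t => by simp⟩
  | add x y _ _ hx hy =>
    obtain ⟨P, hP⟩ := hx
    obtain ⟨Q, hQ⟩ := hy
    exact ⟨P + Q, fun t => by simp [hP, hQ]⟩
  | mul x y _ _ hx hy =>
    obtain ⟨P, hP⟩ := hx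
    obtain ⟨Q, hQ⟩ := hy
    exact ⟨P * Q, fun t => by simp [hP, hQ]⟩

theorem exists_polynomial_of_action (ρ : AlgAction Ga A) (f : A) :
    ∃ F : A[X], ∀ t : ℂ, ρ.hom (Multiplicative.ofAdd t) f = F.eval (algebraMap ℂ A t) := by
  obtain ⟨n, r, a, hr, h⟩ := ρ.algebraic f
  choose P hP using fun i => exists_polynomial_of_mem_coordRing_Ga (hr i)
  refine ⟨∑ i, (P i).map (algebraMap ℂ A) * C (a i), fun t => ?_⟩
  rw [h, eval_finsetSum]
  refine Finset.sum_congr rfl fun i _ => ?_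
  rw [hP, eval_mul, eval_C, eval_map, eval₂_at_apply, Algebra.smul_def]

variable [IsDomain A]

theorem polynomial_eq_of_eval_eq {F G : A[X]}
    (h : ∀ t : ℂ, F.eval (algebraMap ℂ A t) = G.eval (algebraMap ℂ A t)) : F = G := by
  refine Polynomial.eq_of_infinite_eval_eq F G (Set.Infinite.mono ?_
    (Set.infinite_range_of_injective (algebraMap ℂ A).injective))
  rintro _ ⟨t, rfl⟩
  exact h t

/-- The locally nilpotent derivation generating an action of `ℂ₊`. -/
theorem exists_locallyNilpotent_of_action (ρ : AlgAction Ga A) :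
    ∃ D : Derivation ℂ A A, LocallyNilpotent D ∧ (∀ f, D f = 0 ↔ f ∈ invariants ρ ⊤) ∧
      ∀ τ : A ≃ₐ[ℂ] A, (∀ t f, τ (ρ.hom t f) = ρ.hom t (τ f)) → ∀ f, τ (D f) = D (τ f) := by
  choose F hF using exists_polynomial_of_action ρ
  have huniq : ∀ {f : A} {G : A[X]},
      (∀ t : ℂ, ρ.hom (Multiplicative.ofAdd t) f = G.eval (algebraMap ℂ A t)) → F f = G :=
    fun {f G} h => polynomial_eq_of_eval_eq fun t => by rw [← hF, h]
  have hadd : ∀ f g, F (f + g) = F f + F g := fun f g => huniq fun t => by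
    rw [map_add, hF, hF, eval_add]
  have hmul : ∀ f g, F (f * g) = F f * F g := fun f g => huniq fun t => by
    rw [map_mul, hF, hF, eval_mul]
  have hsmul : ∀ (c : ℂ) f, F (c • f) = c • F f := fun c f => huniq fun t => by
    rw [map_smul, hF, eval_smul]
  have h0 : ∀ f, (F f).coeff 0 = f := fun f => by
    have := hF f 0
    rw [ofAdd_zero, map_zero, map_one, ← coeff_zero_eq_eval_zero] at this
    exact this.symm
  let D : Derivation ℂ A A := Derivation.mk' ⟨⟨fun f => (F f).coeff 1, fun f g => by
    rw [hadd, coeff_add]⟩, fun c f => by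
      change (F (c • f)).coeff 1 = c • (F f).coeff 1
      rw [hsmul, coeff_smul]⟩ fun f g => by
      change (F (f * g)).coeff 1 = f * (F g).coeff 1 + g * (F f).coeff 1
      rw [hmul, mul_coeff_one, h0, h0]
      ring
  have hD : ∀ f, D f = (F f).coeff 1 := fun f => rfl
  have hcomm : ∀ τ : A ≃ₐ[ℂ] A, (∀ t f, τ (ρ.hom t f) = ρ.hom t (τ f)) →
      ∀ f, τ (D f) = D (τ f) := by
    intro τ hτ f
    have : F (τ f) = (F f).map (τ : A →+* A) := huniq fun t => by
      have h1 : algebraMap ℂ A t = (τ : A →+* A) (algebraMap ℂ A t) := (τ.commutes t).symm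
      rw [← hτ, hF, eval_map, h1, eval₂_at_apply]
      rw [← h1]
      rfl
    rw [hD, hD, this, coeff_map]
    rfl
  -- The group law says that `F (ρ t f)` is the translate of `F f` by `t`; its linear coefficient is
  -- the derivative of `F f` at `t`.
  have hder : ∀ f, F (D f) = derivative (F f) := by
    intro f
    refine huniq fun t => ?_
    rw [hcomm (ρ.hom (Multiplicative.ofAdd t)) (fun s g => by
      rw [← AlgEquiv.mul_apply, ← AlgEquiv.mul_apply, ← map_mul, ← map_mul, mul_comm]), hD]
    have : F (ρ.hom (Multiplicative.ofAdd t) f) = (F f).comp (X + C (algebraMap ℂ A t)) := by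
      refine huniq fun s => ?_
      rw [← AlgEquiv.mul_apply, ← map_mul, ← ofAdd_add, hF, eval_comp]
      simp
    rw [this, ← taylor_apply, taylor_coeff_one]
  refine ⟨D, fun f => ?_, fun f => ?_, hcomm⟩
  · have hit : ∀ n, F ((⇑D)^[n] f) = derivative^[n] (F f) := by
      intro n
      induction n with
      | zero => rfl
      | succ n ih => rw [Function.iterate_succ_apply', hder, ih, Function.iterate_succ_apply']
    refine ⟨(F f).natDegree + 1, ?_⟩
    rw [← h0 ((⇑D)^[_] f), hit, iterate_derivative_eq_zero (Nat.lt_succ_self _), coeff_zero]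
  · constructor
    · intro hf h _
      have hz : derivative (F f) = 0 := by
        rw [← hder, hf]
        exact huniq fun t => by simp
      have : CharZero A := charZero_of_injective_algebraMap (algebraMap ℂ A).injective
      have hc := derivative_eq_zero.1 hz
      rw [natDegree_eq_zero] at hc
      obtain ⟨c, hc⟩ := hc
      have := hF f (Multiplicative.toAdd h)
      rw [ofAdd_toAdd, ← hc, eval_C] at this
      rw [this, ← h0 f, ← hc, coeff_C_zero]
    · intro hf
      have : F f = C f := huniq fun t => by rw [eval_C]; exact hf _ trivial
      rw [hD, this, coeff_C_succ]

end Additive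

/-! ### Invariants under a finite equivariant morphism -/

section Finite

variable {A A' : Type*}
  [CommRing A] [Algebra ℂ A] [IsDomain A]
  [CommRing A'] [Algebra ℂ A'] [IsDomain A'] [IsIntegrallyClosed A']

/-- Functions fixed by compatible automorphisms are integral over the functions fixed below. -/
theorem exists_monic_of_fixed (p : A' →ₐ[ℂ] A) (hp : Function.Injective p)
    (hfin : p.Finite) {ι : Type*} (τ : ι → A ≃ₐ[ℂ] A) (τ' : ι → A' ≃ₐ[ℂ] A')
    (h : ∀ i a, τ i (p a) = p (τ' i a)) (b : A) (hb : ∀ i, τ i b = b) :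
    ∃ P : A'[X], P.Monic ∧ P.eval₂ (p : A' →+* A) b = 0 ∧ ∀ n i, τ' i (P.coeff n) = P.coeff n := by
  let : Algebra A' A := p.toRingHom.toAlgebra
  have : FaithfulSMul A' A := (faithfulSMul_iff_algebraMap_injective _ _).2 hp
  have : Module.Finite A' A := hfin
  have hint : IsIntegral A' b := Algebra.IsIntegral.isIntegral b
  exact ⟨minpoly A' b, minpoly.monic hint, minpoly.aeval A' b,
    fun n i => map_coeff_minpoly_of_fixed (τ i) (τ' i) (h i) hint (hb i) n⟩

/-- Arbitrary families of compatible automorphisms suffice for the descent, so both cases of the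
theorem reduce to `hfrac`. -/
theorem idealCondition_of_fixed [IsIntegrallyClosed A] (p : A' →ₐ[ℂ] A) (hp : Function.Injective p)
    (hfin : p.Finite) {ι κ : Type*} (σ : ι → A ≃ₐ[ℂ] A) (σ' : ι → A' ≃ₐ[ℂ] A')
    (hσ : ∀ i a, σ i (p a) = p (σ' i a)) (τ : κ → A ≃ₐ[ℂ] A) (τ' : κ → A' ≃ₐ[ℂ] A')
    (hτ : ∀ i a, τ i (p a) = p (τ' i a)) {B₁ B₂ : Subalgebra ℂ A} {B₁' B₂' : Subalgebra ℂ A'}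
    (h₁ : ∀ f, f ∈ B₁ ↔ ∀ i, σ i f = f) (h₂ : ∀ f, f ∈ B₂ ↔ ∀ i, τ i f = f)
    (h₁' : ∀ f, f ∈ B₁' ↔ ∀ i, σ' i f = f) (h₂' : ∀ f, f ∈ B₂' ↔ ∀ i, τ' i f = f)
    (hfrac : ∀ a : A', ∃ d ∈ B₁' ⊔ B₂', d ≠ 0 ∧ d * a ∈ B₁' ⊔ B₂')
    (hI : IdealCondition B₁ B₂) : IdealCondition B₁' B₂' := by
  let : Algebra A' A := p.toRingHom.toAlgebra
  have : FaithfulSMul A' A := (faithfulSMul_iff_algebraMap_injective _ _).2 hp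
  have : Module.Finite A' A := hfin
  have : IsScalarTower ℂ A' A := IsScalarTower.of_algebraMap_eq fun c => (p.commutes c).symm
  have e₁ : B₁' = B₁.comap (IsScalarTower.toAlgHom ℂ A' A) := by
    ext f
    rw [h₁', Subalgebra.mem_comap, h₁]
    exact forall_congr' fun i => ⟨fun h => (hσ i f).trans (congrArg p h),
      fun h => hp ((hσ i f).symm.trans h)⟩
  have e₂ : B₂' = B₂.comap (IsScalarTower.toAlgHom ℂ A' A) := by
    ext f
    rw [h₂', Subalgebra.mem_comap, h₂]
    exact forall_congr' fun i => ⟨fun h => (hτ i f).trans (congrArg p h),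
      fun h => hp ((hτ i f).symm.trans h)⟩
  have key : ∀ (σ : A ≃ₐ[ℂ] A) (σ' : A' ≃ₐ[ℂ] A') (_ : ∀ a, σ (p a) = p (σ' a)) (b : A)
      (_ : σ b = b), σ (algebraMap A' A (minpoly A' b).nextCoeff) =
        algebraMap A' A (minpoly A' b).nextCoeff := by
    intro σ σ' h b hb
    refine (h _).trans (congrArg p ?_)
    rw [nextCoeff]
    split_ifs
    · exact map_zero _
    · exact map_coeff_minpoly_of_fixed σ σ' h (Algebra.IsIntegral.isIntegral b) hb _
  rw [e₁, e₂]
  rw [e₁, e₂] at hfrac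
  refine idealCondition_comap B₁ B₂ (fun b hb => ?_) (fun b hb => ?_) hfrac hI
  · rw [h₁] at hb ⊢
    exact fun i => key _ _ (hσ i) b (hb i)
  · rw [h₂] at hb ⊢
    exact fun i => key _ _ (hτ i) b (hb i)

end Finite

/-! ### The commuting case -/

section Commuting

variable {A A' : Type*}
  [CommRing A] [Algebra ℂ A] [IsDomain A]
  [CommRing A'] [Algebra ℂ A'] [IsDomain A'] [IsIntegrallyClosed A']

/-- The action of the factor `ℂ₊` of a product. -/
def AlgAction.inl {H : Type} [Group H] [RegularFunctions H] (ρ : AlgAction (Ga × H) A) :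
    AlgAction Ga A where
  hom := ρ.hom.comp (MonoidHom.inl Ga H)
  algebraic f := by
    obtain ⟨n, r, a, hr, h⟩ := ρ.algebraic f
    refine ⟨n, fun i t => r i (t, 1), a, fun i => ?_, fun t => h (t, 1)⟩
    change (fun t => r i (t, 1)) ∈ RegularFunctions.coordRing (G := Ga)
    have hri := hr i
    generalize r i = u at hri
    induction hri using Algebra.adjoin_induction with
    | mem x hx =>
      rcases hx with ⟨r, hr, rfl⟩ | ⟨r, hr, rfl⟩
      · exact hr
      · exact Subalgebra.algebraMap_mem (RegularFunctions.coordRing (G := Ga)) (r 1)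
    | algebraMap c => exact Subalgebra.algebraMap_mem (RegularFunctions.coordRing (G := Ga)) c
    | add x y _ _ hx hy => exact Subalgebra.add_mem _ hx hy
    | mul x y _ _ hx hy => exact Subalgebra.mul_mem _ hx hy

/-- Only the `ℂ₊` factor needs a locally nilpotent generator. Commutation with `H` makes that
generator preserve the `H`-invariants, so that a slice can be sought among them. -/
theorem idealCondition_of_commuting [IsIntegrallyClosed A]
    (p : A' →ₐ[ℂ] A) (hp : Function.Injective p) (hfin : p.Finite)
    {H : Type} [Group H] [RegularFunctions H] (ρ₁ : AlgAction Ga A) (ρ₂ : AlgAction H A)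
    (ρ' : AlgAction (Ga × H) A') (hρ₁ : ρ₁.hom ≠ 1)
    (h₁ : ∀ h f, p (ρ'.hom (h, 1) f) = ρ₁.hom h (p f))
    (h₂ : ∀ h f, p (ρ'.hom (1, h) f) = ρ₂.hom h (p f))
    (hI : IdealCondition (invariants ρ₁ ⊤) (invariants ρ₂ ⊤)) :
    IdealCondition (invariants ρ' (Subgroup.prod ⊤ ⊥)) (invariants ρ' (Subgroup.prod ⊥ ⊤)) := by
  have hB₁ : ∀ f, f ∈ invariants ρ' (Subgroup.prod ⊤ ⊥) ↔ ∀ t : Ga, ρ'.hom (t, 1) f = f := by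
    refine fun f => ⟨fun hf t => hf (t, 1) ⟨trivial, rfl⟩, fun hf => ?_⟩
    rintro ⟨t, s⟩ ⟨-, hs⟩
    rw [show s = 1 from hs]; exact hf t
  have hB₂ : ∀ f, f ∈ invariants ρ' (Subgroup.prod ⊥ ⊤) ↔ ∀ t : H, ρ'.hom (1, t) f = f := by
    refine fun f => ⟨fun hf t => hf (1, t) ⟨rfl, trivial⟩, fun hf => ?_⟩
    rintro ⟨t, s⟩ ⟨ht, -⟩
    rw [show t = 1 from ht]; exact hf s
  have hall : ∀ {G : Type} [Group G] [RegularFunctions G] (ρ : AlgAction G A) (f : A),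
      f ∈ invariants ρ ⊤ ↔ ∀ t : G, ρ.hom t f = f :=
    fun ρ f => ⟨fun h t => h t trivial, fun h t _ => h t⟩
  refine idealCondition_of_fixed p hp hfin (fun t => ρ₁.hom t) (fun t => ρ'.hom (t, 1))
    (fun t a => (h₁ t a).symm) (fun t => ρ₂.hom t) (fun t => ρ'.hom (1, t))
    (fun t a => (h₂ t a).symm) (hall ρ₁) (hall ρ₂) hB₁ hB₂ ?_ hI
  obtain ⟨D, hD, hker, hcomm⟩ := exists_locallyNilpotent_of_action ρ'.inl
  have hker' : ∀ f, D f = 0 ↔ f ∈ invariants ρ' (Subgroup.prod ⊤ ⊥) := fun f => by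
    rw [hker, hB₁]
    exact ⟨fun h t => h t trivial, fun h t _ => h t⟩
  have hstab : ∀ b ∈ invariants ρ' (Subgroup.prod ⊥ ⊤),
      D b ∈ invariants ρ' (Subgroup.prod ⊥ ⊤) := by
    intro b hb
    rw [hB₂] at hb ⊢
    intro h
    rw [hcomm (ρ'.hom (1, h)) (fun t f => ?_), hb]
    change ρ'.hom (1, h) (ρ'.hom (t, 1) f) = ρ'.hom (t, 1) (ρ'.hom (1, h) f)
    rw [← AlgEquiv.mul_apply, ← AlgEquiv.mul_apply, ← map_mul, ← map_mul]
    simp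
  by_cases hne : ∃ b ∈ invariants ρ' (Subgroup.prod ⊥ ⊤), D b ≠ 0
  · obtain ⟨b, hb, hDb⟩ := hne
    obtain ⟨t, ht, ht0, ht1⟩ := exists_slice D hD _ hstab hb hDb
    intro a
    obtain ⟨N, hN⟩ := exists_pow_mul_mem_of_slice D hD
      (invariants ρ' (Subgroup.prod ⊤ ⊥) ⊔ invariants ρ' (Subgroup.prod ⊥ ⊤))
      (fun a ha => (le_sup_left : invariants ρ' (Subgroup.prod ⊤ ⊥) ≤ _ ⊔ _) ((hker' a).1 ha))
      ((le_sup_right : invariants ρ' (Subgroup.prod ⊥ ⊤) ≤ _ ⊔ _) ht) ht1 a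
    exact ⟨D t ^ N, Subalgebra.pow_mem _ ((le_sup_left : invariants ρ' (Subgroup.prod ⊤ ⊥) ≤ _ ⊔ _)
      ((hker' _).1 ht1)) _, pow_ne_zero _ ht0, hN⟩
  · exfalso
    push Not at hne
    -- The `H`-invariant coefficients of an integral equation of `b` are now `ℂ₊`-invariant too. So
    -- the whole `ℂ₊`-orbit of `b` consists of roots of one monic polynomial; being parametrized by
    -- a polynomial `F` in `t`, it is constant.
    have hle : invariants ρ₂ ⊤ ≤ invariants ρ₁ ⊤ := by
      intro b hb
      obtain ⟨P, hP, hPb, hPc⟩ := exists_monic_of_fixed p hp hfin (fun t => ρ₂.hom t)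
        (fun t => ρ'.hom (1, t)) (fun t a => (h₂ t a).symm) b (fun i => hb i trivial)
      have hPc' : ∀ n (t : Ga), ρ₁.hom t (p (P.coeff n)) = p (P.coeff n) := by
        intro n t
        rw [← h₁, (hB₁ _).1 ((hker' _).1 (hne _ ((hB₂ _).2 (hPc n))))]
      obtain ⟨F, hF⟩ := exists_polynomial_of_action ρ₁ b
      have hroot : ∀ t : ℂ, (P.map (p : A' →+* A)).IsRoot (F.eval (algebraMap ℂ A t)) := by
        intro t
        set τ := ρ₁.hom (Multiplicative.ofAdd t)
        have hm : (P.map (p : A' →+* A)).map (τ : A →+* A) = P.map (p : A' →+* A) := by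
          ext n
          rw [coeff_map, coeff_map]
          exact hPc' n _
        rw [IsRoot, ← hF, ← hm, eval_map]
        have := Polynomial.hom_eval₂ (P.map (p : A' →+* A)) (RingHom.id A) (τ : A →+* A) b
        rw [eval₂_id, eval_map, hPb, map_zero, RingHom.comp_id] at this
        exact this.symm
      have hz : (P.map (p : A' →+* A)).comp F = 0 := polynomial_eq_of_eval_eq fun t => by
        rw [eval_comp, hroot t, eval_zero]
      rcases comp_eq_zero_iff.1 hz with h0 | ⟨-, h0⟩
      · exact absurd h0 (hP.map _).ne_zero
      · have hconst : ∀ t, ρ₁.hom t b = F.coeff 0 := fun t => by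
          have := hF (Multiplicative.toAdd t)
          rwa [ofAdd_toAdd, h0, eval_C] at this
        intro t _
        rw [hconst, ← hconst 1, map_one]
        rfl
    obtain ⟨I, hI0, hI⟩ := (idealCondition_iff _ _).1 hI
    rw [sup_eq_left.2 hle] at hI
    obtain ⟨s, hs, hs0⟩ := Submodule.exists_mem_ne_zero_of_ne_bot hI0
    -- An ideal of invariants forces triviality: `s` and `s * a` are invariant and `s ≠ 0`, hence
    -- `a` is invariant.
    refine hρ₁ (MonoidHom.ext fun t => AlgEquiv.ext fun a => ?_)
    have e1 : ρ₁.hom t (s * a) = s * a := hI _ (I.mul_mem_right a hs) t trivial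
    rw [map_mul, hI _ hs t trivial] at e1
    exact mul_left_cancel₀ hs0 e1

end Commuting

/-! ### Derivations of fields and algebraic elements -/

section FractionField

/-- The extension of a derivation to the field of fractions. -/
theorem exists_derivation_fractionRing {A K : Type*} [CommRing A] [Algebra ℂ A] [IsDomain A]
    [Field K] [Algebra A K] [IsFractionRing A K] (D : Derivation ℂ A A) :
    ∃ D' : Derivation ℤ K K, ∀ a, D' (algebraMap A K a) = algebraMap A K (D a) := by
  -- A derivation is a ring homomorphism `a ↦ a + ε D a` to the dual numbers, and this extends to
  -- fractions by the universal property of localization.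
  let φ : A →+* TrivSqZeroExt K K :=
    { toFun := fun a => TrivSqZeroExt.inl (algebraMap A K a) +
        TrivSqZeroExt.inr (algebraMap A K (D a))
      map_one' := by simp
      map_zero' := by simp
      map_add' := fun a b => by ext <;> simp [Algebra.smul_def]
      map_mul' := fun a b => by 
        ext <;> simp only [TrivSqZeroExt.fst_mul, TrivSqZeroExt.snd_mul, TrivSqZeroExt.fst_add,
          TrivSqZeroExt.snd_add, TrivSqZeroExt.fst_inl, TrivSqZeroExt.snd_inl,
          TrivSqZeroExt.fst_inr, TrivSqZeroExt.snd_inr, map_mul, D.leibniz, map_add, smul_eq_mul,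
          op_smul_eq_smul, add_zero, zero_add] }
  have hφ : ∀ y : nonZeroDivisors A, IsUnit (φ y) := fun y => by
    rw [TrivSqZeroExt.isUnit_iff_isUnit_fst]
    have : (φ y).fst = algebraMap A K y := by simp [φ]
    rw [this, isUnit_iff_ne_zero]
    simp
  let L : K →+* TrivSqZeroExt K K := IsLocalization.lift hφ
  have hL : ∀ a, L (algebraMap A K a) = φ a := fun a => IsLocalization.lift_eq hφ a
  have hfst : ∀ x, (L x).fst = x := by
    have : ((TrivSqZeroExt.fstHom K K K : TrivSqZeroExt K K →ₐ[K] K) :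
        TrivSqZeroExt K K →+* K).comp L = RingHom.id K := by
      refine IsLocalization.ringHom_ext (nonZeroDivisors A) ?_
      ext a
      simp [hL, φ]
    exact fun x => RingHom.congr_fun this x
  refine ⟨Derivation.mk' (AddMonoidHom.toIntLinearMap
    ⟨⟨fun x => (L x).snd, by simp⟩, fun x y => by simp⟩) fun x y => ?_, fun a => ?_⟩
  · change (L (x * y)).snd = x • (L y).snd + y • (L x).snd
    rw [map_mul, TrivSqZeroExt.snd_mul, hfst, hfst, op_smul_eq_smul]
  · change (L _).snd = _
    rw [hL]
    exact (zero_add _)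

variable {K : Type*} [Field K]

/-- The difference is the polynomial with `D` applied to its coefficients, evaluated at `x`. For the
minimal polynomial of `x` this determines `D x` in `L`, by separability. -/
theorem derivation_aeval_sub_mem (D : Derivation ℤ K K) (N L : Subfield K)
    (hN : ∀ x ∈ N, x ∈ L ∧ D x ∈ L) {x : K} (hx : x ∈ L) (q : N[X]) :
    D (aeval x q) - aeval x (derivative q) * D x ∈ L := by
  induction q using Polynomial.induction_on' with
  | add p q hp hq =>
    have := L.add_mem hp hq
    simp only [map_add]
    convert this using 1
    ring
  | monomial n a =>
    rw [aeval_monomial, derivative_monomial, aeval_monomial, D.leibniz, D.leibniz_pow]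
    have : algebraMap N K a • n • x ^ (n - 1) • D x + x ^ n • D (algebraMap N K a) -
        algebraMap N K (a * (n : N)) * x ^ (n - 1) * D x = x ^ n * D (algebraMap N K a) := by
      simp only [smul_eq_mul, nsmul_eq_mul, map_mul, map_natCast]
      ring
    rw [this]
    exact L.mul_mem (L.pow_mem hx n) (hN _ a.2).2

theorem derivation_aeval_of_eq_zero (D : Derivation ℤ K K) (N : Subfield K)
    (hN : ∀ x ∈ N, D x = 0) (x : K) (q : N[X]) :
    D (aeval x q) = aeval x (derivative q) * D x := by
  induction q using Polynomial.induction_on' with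
  | add p q hp hq => simp only [map_add, hp, hq]; ring
  | monomial n a =>
    rw [aeval_monomial, derivative_monomial, aeval_monomial, D.leibniz, D.leibniz_pow,
      show D (algebraMap N K a) = 0 from hN _ a.2]
    simp only [smul_eq_mul, nsmul_eq_mul, map_mul, map_natCast]
    ring

theorem aeval_derivative_minpoly_ne_zero [CharZero K] (N : Subfield K) {x : K} (hx : IsAlgebraic N x) :
    aeval x (derivative (minpoly N x)) ≠ 0 :=
  (minpoly.irreducible hx.isIntegral).separable.aeval_derivative_ne_zero (minpoly.aeval N x)

/-- A derivation mapping `N` into `L` also maps the elements of `L` that are algebraic over `N`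
into `L`. -/
theorem derivation_mem_of_isAlgebraic [CharZero K] (D : Derivation ℤ K K) (N L : Subfield K)
    (hN : ∀ x ∈ N, x ∈ L ∧ D x ∈ L) {x : K} (hx : x ∈ L) (halg : IsAlgebraic N x) : D x ∈ L := by
  have h := derivation_aeval_sub_mem D N L hN hx (minpoly N x)
  have hmem : ∀ q : N[X], aeval x q ∈ L := by
    intro q
    rw [aeval_eq_sum_range]
    exact L.sum_mem fun i _ => L.mul_mem (hN _ (q.coeff i).2).1 (L.pow_mem hx i)
  rw [minpoly.aeval, map_zero, zero_sub, ← mul_neg] at h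
  have := L.mul_mem (L.inv_mem (hmem (derivative (minpoly N x)))) h
  rw [inv_mul_cancel_left₀ (aeval_derivative_minpoly_ne_zero N halg)] at this
  simpa using L.neg_mem this

theorem not_isAlgebraic_of_derivation_ne_zero [CharZero K] (D : Derivation ℤ K K) (N : Subfield K)
    (hN : ∀ x ∈ N, D x = 0) {x : K} (hx : D x ≠ 0) : ¬ IsAlgebraic N x := by
  intro halg
  have h := derivation_aeval_of_eq_zero D N hN x (minpoly N x)
  rw [minpoly.aeval, map_zero] at h
  exact mul_ne_zero (aeval_derivative_minpoly_ne_zero N halg) hx h.symm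

/-- If `K` is algebraic over `N[t]` and `r` is transcendental over `N`, then `K` is algebraic
over `N(r)`. -/
theorem isAlgebraic_adjoin_of_transcendental (N : Subfield K) {t r : K}
    (ht : ∀ x : K, IsAlgebraic (Algebra.adjoin N {t}) x) (hr : Transcendental N r) (x : K) :
    IsAlgebraic (IntermediateField.adjoin N {r}) x := by
  have : Algebra.IsAlgebraic (Algebra.adjoin N {t}) K := ⟨ht⟩
  have hdeg : Algebra.trdeg N K ≤ Cardinal.mk ({t} : Set K) := Algebra.IsAlgebraic.trdeg_le_cardinalMk N {t}
  have hb : IsTranscendenceBasis N ((↑) : ({r} : Set K) → K) := by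
    refine AlgebraicIndependent.isTranscendenceBasis_of_trdeg_le_of_finite ?_ ?_
    · exact (algebraicIndependent_singleton_iff (i := ⟨r, rfl⟩)).2 hr
    · simpa using hdeg
  have := hb.isAlgebraic_field
  rw [Subtype.range_coe] at this
  exact this.isAlgebraic x

end FractionField

/-! ### Independent `sl₂`-triples: the kernels of `E` and `F` generate the fraction field -/

section SlTriple

variable {A : Type*} [CommRing A] [Algebra ℂ A] {E F H : Derivation ℂ A A}

theorem iterate_weight (hHE : ∀ a, H (E a) = E (H a) + 2 * E a) (n : ℕ) (v : A) :
    H ((⇑E)^[n] v) = (⇑E)^[n] (H v) + 2 * n * (⇑E)^[n] v := by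
  induction n with
  | zero => simp
  | succ n ih =>
    rw [Function.iterate_succ_apply', Function.iterate_succ_apply', hHE, ih, map_add]
    have : E (2 * (n : A)) = 0 := by exact_mod_cast E.map_natCast (2 * n)
    rw [E.leibniz, this]
    push_cast
    simp only [smul_eq_mul]
    ring

/-- The usual commutator of `F` with powers of `E` on a lowest weight vector, for vectors that need
not be eigenvectors of `H`. -/
theorem lower_iterate_raise (hFE : ∀ a, F (E a) = E (F a) - H a)
    (hHE : ∀ a, H (E a) = E (H a) + 2 * E a) (n : ℕ) {v : A} (hv : F v = 0) :
    F ((⇑E)^[n + 1] v) = -(n + 1) * (⇑E)^[n] (H v + n * v) := by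
  have hlin : ∀ (c : A) (_ : E c = 0) (m : ℕ) (x y : A),
      (⇑E)^[m] (x + c * y) = (⇑E)^[m] x + c * (⇑E)^[m] y := fun c hc m x y => by
    rw [iterate_map_add, derivation_iterate_mul_of_eq_zero E hc]
  induction n with
  | zero => simp [hFE, hv]
  | succ n ih =>
    rw [Function.iterate_succ_apply' (⇑E) (n + 1), hFE, ih, iterate_weight hHE,
      hlin _ (by simp), hlin _ (by simp), E.leibniz, map_add, E.leibniz]
    rw [show E (-((n : A) + 1)) = 0 by simp, show E (n : A) = 0 by simp,
      ← Function.iterate_succ_apply' (⇑E), ← Function.iterate_succ_apply' (⇑E)]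
    push_cast
    simp only [smul_eq_mul]
    ring

/-- The kernel of the lowering operator is spanned by its weight vectors. -/
theorem mem_span_weight_vectors (hFE : ∀ a, F (E a) = E (F a) - H a)
    (hHE : ∀ a, H (E a) = E (H a) + 2 * E a) (hHF : ∀ a, H (F a) = F (H a) - 2 * F a)
    (n : ℕ) {v : A} (hv : F v = 0) (hn : (⇑E)^[n] v = 0) :
    v ∈ Submodule.span ℂ {u : A | F u = 0 ∧ ∃ k < n, H u = -(k : A) * u} := by
  induction n generalizing v with
  | zero => rw [show v = 0 from hn]; exact zero_mem _
  | succ n ih =>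
    have hF : F (H v + n * v) = 0 := by
      have := hHF v
      rw [hv, map_zero, mul_zero, sub_zero] at this
      rw [map_add, ← this, F.leibniz, hv]
      simp
    have hE : (⇑E)^[n] (H v + n * v) = 0 := by
      have := lower_iterate_raise hFE hHE n hv
      rw [hn, map_zero] at this
      have h2 : ((n : ℂ) + 1) • (⇑E)^[n] (H v + n * v) = 0 := by
        rw [Algebra.smul_def]
        simp only [map_add, map_natCast, map_one]
        linear_combination this
      exact (smul_eq_zero.1 h2).resolve_left (by exact_mod_cast n.succ_ne_zero)
    have hu := ih hF hE
    -- On weights `-k` with `k < n` the operator `H + n` is the nonzero scalar `n - k`, so it can be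
    -- inverted there. Then `v - w` is killed by `H + n`, hence has weight `-n`.
    obtain ⟨w, hw, hwu⟩ : ∃ w ∈ Submodule.span ℂ {u : A | F u = 0 ∧ ∃ k < n, H u = -(k : A) * u},
        F w = 0 ∧ H w + n * w = H v + n * v := by
      generalize H v + n * v = u at hu
      induction hu using Submodule.span_induction with
      | mem u hu =>
        obtain ⟨hFu, k, hk, hku⟩ := id hu
        have hnk : ((n : ℂ) - k) ≠ 0 := sub_ne_zero.2 (by exact_mod_cast hk.ne')
        refine ⟨((n : ℂ) - k)⁻¹ • u, Submodule.smul_mem _ _ (Submodule.subset_span hu), ?_, ?_⟩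
        · rw [F.map_smul, hFu, smul_zero]
        · rw [H.map_smul, hku, mul_smul_comm, ← smul_add]
          have : -(k : A) * u + n * u = ((n : ℂ) - k) • u := by
            rw [Algebra.smul_def]
            simp only [map_sub, map_natCast]
            ring
          rw [this, smul_smul, inv_mul_cancel₀ hnk, one_smul]
      | zero => exact ⟨0, zero_mem _, by simp, by simp⟩
      | add x y _ _ hx hy =>
        obtain ⟨a, ha, ha1, ha2⟩ := hx
        obtain ⟨b, hb, hb1, hb2⟩ := hy
        refine ⟨a + b, add_mem ha hb, by rw [map_add, ha1, hb1, add_zero], ?_⟩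
        rw [map_add, ← ha2, ← hb2]; ring
      | smul c x _ hx =>
        obtain ⟨a, ha, ha1, ha2⟩ := hx
        refine ⟨c • a, Submodule.smul_mem _ _ ha, by rw [F.map_smul, ha1, smul_zero], ?_⟩
        rw [H.map_smul, ← ha2, smul_add, mul_smul_comm]
    have hvw : v = (v - w) + w := by ring
    rw [hvw]
    refine add_mem (Submodule.subset_span ⟨by rw [map_sub, hv, hwu.1, sub_zero], n,
      Nat.lt_succ_self n, ?_⟩) (Submodule.span_mono ?_ hw)
    · rw [map_sub]; linear_combination -hwu.2
    · rintro u ⟨h1, k, hk, h2⟩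
      exact ⟨h1, k, hk.trans (Nat.lt_succ_self n), h2⟩

variable [IsDomain A]

/-- A derivation killing `ker F` and a local slice of `F` is zero. -/
theorem derivation_eq_zero_of_slice (hF : LocallyNilpotent F) (D : Derivation ℂ A A) {t : A}
    (ht0 : F t ≠ 0) (ht : F (F t) = 0) (hD : ∀ a, F a = 0 → D a = 0) (hDt : D t = 0) (a : A) :
    D a = 0 := by
  let S : Subalgebra ℂ A :=
    { carrier := {a | D a = 0}
      mul_mem' := fun {x y} (hx : D x = 0) (hy : D y = 0) =>
        show D (x * y) = 0 by rw [D.leibniz, hx, hy]; simp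
      add_mem' := fun {x y} (hx : D x = 0) (hy : D y = 0) =>
        show D (x + y) = 0 by rw [map_add, hx, hy, add_zero]
      algebraMap_mem' := fun c => D.map_algebraMap c }
  obtain ⟨N, hN⟩ := exists_pow_mul_mem_of_slice F hF S hD hDt ht a
  have hN' : D (F t ^ N * a) = 0 := hN
  have hg : D (F t ^ N) = 0 := by rw [D.leibniz_pow, hD _ ht]; simp
  rw [D.leibniz, hg, smul_zero, add_zero, smul_eq_mul] at hN'
  exact (mul_eq_zero.1 hN').resolve_left (pow_ne_zero _ ht0)

/-- If `E`, `F`, `H` are linearly independent, then two weight vectors in `ker F` of the same weight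
have a quotient that `E` does not kill. -/
theorem exists_weight_vectors (hE : LocallyNilpotent E) (hF : LocallyNilpotent F)
    (hFE : ∀ a, F (E a) = E (F a) - H a)
    (hHE : ∀ a, H (E a) = E (H a) + 2 * E a) (hHF : ∀ a, H (F a) = F (H a) - 2 * F a)
    (hind : ∀ α β γ : A, (∀ a, α * E a + β * F a + γ * H a = 0) → α = 0 ∧ β = 0 ∧ γ = 0) :
    ∃ (P Q : A) (k : ℕ), F P = 0 ∧ F Q = 0 ∧ H P = -(k : A) * P ∧ H Q = -(k : A) * Q ∧
      Q * E P - P * E Q ≠ 0 := by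
  by_contra hcon
  push Not at hcon
  have hCZ : CharZero A := charZero_of_injective_algebraMap (algebraMap ℂ A).injective
  have hF0 : ∃ b, F b ≠ 0 := by
    by_contra h
    push Not at h
    exact one_ne_zero (hind 0 1 0 fun a => by simp [h a]).2.1
  obtain ⟨b, hb⟩ := hF0
  obtain ⟨t, -, ht0, ht⟩ := exists_slice F hF Set.univ (fun _ _ => trivial) (Set.mem_univ b) hb
  have hweight : ∀ D : Derivation ℂ A A,
      (∀ (Q : A) (m : ℕ), F Q = 0 → H Q = -(m : A) * Q → D Q = 0) → ∀ a, F a = 0 → D a = 0 := by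
    intro D hD a ha
    obtain ⟨n, hn⟩ := hE a
    have := mem_span_weight_vectors hFE hHE hHF n ha hn
    clear ha hn
    induction this using Submodule.span_induction with
    | mem u hu => obtain ⟨h1, k, -, h2⟩ := hu; exact hD u k h1 h2
    | zero => exact map_zero D
    | add x y _ _ hx hy => rw [map_add, hx, hy, add_zero]
    | smul c x _ hx => rw [D.map_smul, hx, smul_zero]
  -- The extra factor `x` avoids the truncated exponent `n - 1`.
  have hpow : ∀ (D : Derivation ℂ A A) (n : ℕ) (x : A), x * D (x ^ n) = n * x ^ n * D x := by
    intro D n x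
    rcases n with _ | n
    · simp
    · rw [D.leibniz_pow]
      simp only [nsmul_eq_mul, smul_eq_mul, Nat.add_sub_cancel]
      ring
  by_cases hP : ∃ (P : A) (k : ℕ), k ≠ 0 ∧ P ≠ 0 ∧ F P = 0 ∧ H P = -(k : A) * P
  · obtain ⟨P, k, hk, hP0, hFP, hHP⟩ := hP
    have hk' : (k : A) ≠ 0 := by exact_mod_cast hk
    -- The coefficients are chosen so that the combination kills `P` and the slice `t`.
    let D : Derivation ℂ A A := (k * P * F t) • E + (-(k * P * E t + E P * H t)) • F + (E P * F t) • H
    have hDa : ∀ a, D a = k * P * F t * E a + -(k * P * E t + E P * H t) * F a + E P * F t * H a :=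
      fun a => rfl
    have hD0 : ∀ a, D a = 0 := by
      refine derivation_eq_zero_of_slice hF D ht0 ht (hweight D fun Q m hFQ hHQ => ?_) ?_
      · rw [hDa, hFQ, hHQ]
        by_cases hQ0 : Q = 0
        · simp [hQ0]
        -- `Q ^ k` and `P ^ m` have the same weight, so the vanishing Wronskian gives `k P E Q = m Q
        -- E P`, which is what `D Q = 0` requires.
        have e1 := hcon (Q ^ k) (P ^ m) (k * m) (by rw [F.leibniz_pow, hFQ]; simp)
          (by rw [F.leibniz_pow, hFP]; simp)
          (mul_left_cancel₀ hQ0 (by rw [hpow, hHQ]; push_cast; ring))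
          (mul_left_cancel₀ hP0 (by rw [hpow, hHP]; push_cast; ring))
        have e2 := hpow E k Q
        have e3 := hpow E m P
        have e4 : P ^ m * Q ^ k * (k * P * E Q - m * Q * E P) = 0 := by
          linear_combination P * Q * e1 - P * P ^ m * e2 + Q * Q ^ k * e3
        have e5 := (mul_eq_zero.1 e4).resolve_left (mul_ne_zero (pow_ne_zero _ hP0) (pow_ne_zero _ hQ0))
        linear_combination F t * e5
      · rw [hDa]; ring
    have := (hind _ _ _ fun a => (hDa a).symm.trans (hD0 a)).1
    exact mul_ne_zero (mul_ne_zero hk' hP0) ht0 this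
  · push Not at hP
    let D : Derivation ℂ A A := (F t) • E + (-E t) • F
    have hDa : ∀ a, D a = F t * E a + -E t * F a := fun a => rfl
    have hD0 : ∀ a, D a = 0 := by
      refine derivation_eq_zero_of_slice hF D ht0 ht (hweight D fun Q m hFQ hHQ => ?_) ?_
      · rw [hDa, hFQ]
        by_cases hQ0 : Q = 0
        · simp [hQ0]
        have hm : m = 0 := by
          by_contra hm
          exact hP Q m hm hQ0 hFQ hHQ
        -- In the absence of nonzero weights `Q` has the weight of the constant `1`, and the
        -- Wronskian of the two is `E Q`.
        have := hcon Q 1 m hFQ (by simp) hHQ (by simp [hm])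
        simp only [one_mul, Derivation.map_one_eq_zero, mul_zero, sub_zero] at this
        rw [this]; ring
      · rw [hDa]; ring
    have := (hind (F t) (-E t) 0 fun a => by rw [zero_mul, add_zero, ← hDa, hD0]).1
    exact ht0 this

/-- Elements of a domain that are fractions of elements of a subalgebra. -/
def fractionClosure (S : Subalgebra ℂ A) : Subalgebra ℂ A where
  carrier := {a | ∃ d ∈ S, d ≠ 0 ∧ d * a ∈ S}
  mul_mem' := by
    rintro a b ⟨d, hd, hd0, h⟩ ⟨e, he, he0, h'⟩
    refine ⟨d * e, S.mul_mem hd he, mul_ne_zero hd0 he0, ?_⟩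
    rw [mul_mul_mul_comm]
    exact S.mul_mem h h'
  add_mem' := by
    rintro a b ⟨d, hd, hd0, h⟩ ⟨e, he, he0, h'⟩
    refine ⟨d * e, S.mul_mem hd he, mul_ne_zero hd0 he0, ?_⟩
    rw [show d * e * (a + b) = e * (d * a) + d * (e * b) by ring]
    exact S.add_mem (S.mul_mem he h) (S.mul_mem hd h')
  algebraMap_mem' c := ⟨1, S.one_mem, one_ne_zero, by
    rw [one_mul]; exact S.algebraMap_mem c⟩

theorem mem_fractionClosure_of_mem_closure {K : Type*} [Field K] [Algebra A K]
    [IsFractionRing A K] (S : Subalgebra ℂ A) {a : A}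
    (h : algebraMap A K a ∈ Subfield.closure (algebraMap A K '' S)) : a ∈ fractionClosure S := by
  have hcl : ∀ y ∈ Subring.closure (algebraMap A K '' S), ∃ s ∈ S, algebraMap A K s = y := by
    intro y hy
    have : algebraMap A K '' S = ((S.toSubring.map (algebraMap A K) : Subring K) : Set K) := rfl
    rw [this, Subring.closure_eq] at hy
    exact hy
  obtain ⟨x, hx, y, hy, hxy⟩ := Subfield.mem_closure_iff.1 h
  obtain ⟨u, hu, rfl⟩ := hcl x hx
  obtain ⟨v, hv, rfl⟩ := hcl y hy
  have hinj := IsFractionRing.injective A K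
  by_cases hv0 : v = 0
  · rw [hv0, map_zero, div_zero] at hxy
    have : a = 0 := hinj (by rw [← hxy, map_zero])
    rw [this]
    exact (fractionClosure S).zero_mem
  · refine ⟨v, hv, hv0, ?_⟩
    have hv0' : algebraMap A K v ≠ 0 := by rwa [Ne, map_eq_zero_iff _ hinj]
    have : v * a = u := hinj (by rw [map_mul, ← hxy, mul_div_cancel₀ _ hv0'])
    rwa [this]

/-- The derivative along `E` of the quotient `w / Q ^ 2 = E (P / Q)` is a fraction of elements of
`ker E` and `ker F` when `P`, `Q` and `w` lie in `ker F`. -/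
theorem wronskian_mem_fractionClosure (K : Type*) [Field K] [Algebra A K] [IsFractionRing A K]
    (hE : LocallyNilpotent E) {P Q w : A} (hw : w = Q * E P - P * E Q) (hw0 : w ≠ 0) (hQ0 : Q ≠ 0)
    (hFP : F P = 0) (hFQ : F Q = 0) (hFw : F w = 0) (hE0 : ∃ b, E b ≠ 0)
    (S : Subalgebra ℂ A) (hSE : ∀ a, E a = 0 → a ∈ S) (hSF : ∀ a, F a = 0 → a ∈ S) :
    Q * E w - 2 * (w * E Q) ∈ fractionClosure S := by
  set z := Q * E w - 2 * (w * E Q) with hz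
  let ι := algebraMap A K
  have hinj : Function.Injective ι := IsFractionRing.injective A K
  have : CharZero A := charZero_of_injective_algebraMap (algebraMap ℂ A).injective
  have : CharZero K := charZero_of_injective_algebraMap hinj
  obtain ⟨D, hD⟩ := exists_derivation_fractionRing (K := K) E
  refine mem_fractionClosure_of_mem_closure (K := K) S ?_
  let L : Subfield K := Subfield.closure (ι '' S)
  have hL : ∀ s ∈ S, ι s ∈ L := fun s hs => Subfield.subset_closure ⟨s, hs, rfl⟩
  -- `N₀` consists of the constants of `D` in `L`, and `N` below of the elements of `L` whose
  -- derivative stays in `L`. The aim is `β` algebraic over `N`, whence `D β ∈ L`.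
  let N₀ : Subfield K :=
    { carrier := {x | x ∈ L ∧ D x = 0}
      mul_mem' := fun {x y} hx hy => ⟨L.mul_mem hx.1 hy.1, by rw [D.leibniz, hx.2, hy.2]; simp⟩
      one_mem' := ⟨L.one_mem, D.map_one_eq_zero⟩
      add_mem' := fun {x y} hx hy => ⟨L.add_mem hx.1 hy.1, by rw [map_add, hx.2, hy.2, add_zero]⟩
      zero_mem' := ⟨L.zero_mem, map_zero D⟩
      neg_mem' := fun {x} hx => ⟨L.neg_mem hx.1, by rw [map_neg, hx.2, neg_zero]⟩
      inv_mem' := fun x hx => ⟨L.inv_mem hx.1, by rw [D.leibniz_inv, hx.2]; simp⟩ }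
  let N : Subfield K :=
    { carrier := {x | x ∈ L ∧ D x ∈ L}
      mul_mem' := fun {x y} hx hy => ⟨L.mul_mem hx.1 hy.1, by
        rw [D.leibniz]; exact L.add_mem (L.mul_mem hx.1 hy.2) (L.mul_mem hy.1 hx.2)⟩
      one_mem' := ⟨L.one_mem, by rw [D.map_one_eq_zero]; exact L.zero_mem⟩
      add_mem' := fun {x y} hx hy => ⟨L.add_mem hx.1 hy.1, by
        rw [map_add]; exact L.add_mem hx.2 hy.2⟩
      zero_mem' := ⟨L.zero_mem, by rw [map_zero]; exact L.zero_mem⟩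
      neg_mem' := fun {x} hx => ⟨L.neg_mem hx.1, by rw [map_neg]; exact L.neg_mem hx.2⟩
      inv_mem' := fun x hx => ⟨L.inv_mem hx.1, by
        rw [D.leibniz_inv]
        exact L.mul_mem (L.neg_mem (L.pow_mem (L.inv_mem hx.1) 2)) hx.2⟩ }
  have hιQ : ι Q ≠ 0 := by rwa [Ne, map_eq_zero_iff _ hinj]
  have hιw : ι w ≠ 0 := by rwa [Ne, map_eq_zero_iff _ hinj]
  set r : K := ι P / ι Q with hr
  set β : K := ι w / ι Q ^ 2 with hβ
  have hdiv : ∀ x y : K, y ≠ 0 → D (x / y) = (y * D x - x * D y) / y ^ 2 := by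
    intro x y hy
    rw [div_eq_mul_inv, D.leibniz, D.leibniz_inv]
    simp only [smul_eq_mul]
    field_simp
    ring
  have hDr : D r = β := by
    rw [hr, hdiv _ _ hιQ, hβ, hw, map_sub, map_mul, map_mul, hD, hD]
  have hDβ : D β = ι z / ι Q ^ 3 := by
    rw [hβ, hdiv _ _ (pow_ne_zero _ hιQ), hz, D.leibniz_pow, hD, hD, map_sub, map_mul, map_mul ι 2,
      map_mul, map_ofNat]
    simp only [smul_eq_mul, nsmul_eq_mul]
    field_simp
    push_cast
    ring
  have hPL : ι P ∈ L := hL P (hSF P hFP)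
  have hQL : ι Q ∈ L := hL Q (hSF Q hFQ)
  have hwL : ι w ∈ L := hL w (hSF w hFw)
  have hrL : r ∈ L := L.div_mem hPL hQL
  have hβL : β ∈ L := L.div_mem hwL (L.pow_mem hQL 2)
  have hβ0 : β ≠ 0 := div_ne_zero hιw (pow_ne_zero _ hιQ)
  obtain ⟨b, hb⟩ := hE0
  obtain ⟨t, -, ht0, ht⟩ := exists_slice E hE Set.univ (fun _ _ => trivial) (Set.mem_univ b) hb
  have hkerN₀ : ∀ a, E a = 0 → ι a ∈ N₀ := fun a ha => ⟨hL a (hSE a ha), by rw [hD, ha, map_zero]⟩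
  -- By the slice theorem `K` has transcendence degree at most one over `N₀`.
  have halg : ∀ x : K, IsAlgebraic (Algebra.adjoin N₀ {ι t}) x := by
    have hA : ∀ a, IsAlgebraic (Algebra.adjoin N₀ {ι t}) (ι a) := by
      intro a
      let T : Subalgebra ℂ A :=
        { carrier := {a | ι a ∈ Algebra.adjoin N₀ {ι t}}
          mul_mem' := fun {x y} hx hy => by
            rw [Set.mem_ofPred_eq, map_mul]; exact mul_mem hx hy
          add_mem' := fun {x y} hx hy => by
            rw [Set.mem_ofPred_eq, map_add]; exact add_mem hx hy
          algebraMap_mem' := fun c =>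
            (Algebra.adjoin N₀ {ι t}).algebraMap_mem ⟨_, hkerN₀ _ (E.map_algebraMap c)⟩ }
      have hker : ∀ a, E a = 0 → a ∈ T := fun a ha =>
        (Algebra.adjoin N₀ {ι t}).algebraMap_mem ⟨_, hkerN₀ a ha⟩
      obtain ⟨n, hn⟩ := exists_pow_mul_mem_of_slice E hE T hker
        (show ι t ∈ Algebra.adjoin N₀ {ι t} from Algebra.subset_adjoin rfl) ht a
      have h1 : ι (E t ^ n) ∈ Algebra.adjoin N₀ {ι t} := T.pow_mem (hker _ ht) n
      have h2 : ι (E t ^ n * a) ∈ Algebra.adjoin N₀ {ι t} := hn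
      have h3 : ι a = ι (E t ^ n * a) * (ι (E t ^ n))⁻¹ := by
        have : ι (E t ^ n) ≠ 0 := by
          rw [Ne, map_eq_zero_iff _ hinj]; exact pow_ne_zero _ ht0
        rw [map_mul, mul_comm (ι (E t ^ n)), mul_inv_cancel_right₀ this]
      rw [h3]
      exact (isAlgebraic_algebraMap (⟨_, h2⟩ : Algebra.adjoin N₀ {ι t})).mul
        (isAlgebraic_algebraMap (⟨_, h1⟩ : Algebra.adjoin N₀ {ι t})).inv
    intro x
    obtain ⟨u, v, -, rfl⟩ := IsFractionRing.div_surjective (A := A) x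
    rw [div_eq_mul_inv]
    exact (hA u).mul (hA v).inv
  have htr : Transcendental N₀ r :=
    not_isAlgebraic_of_derivation_ne_zero D N₀ (fun x hx => hx.2) (by rw [hDr]; exact hβ0)
  have hβalg := isAlgebraic_adjoin_of_transcendental N₀ halg htr β
  have hβN : IsAlgebraic N β := by
    -- `N₀(r) ⊆ N` because `D r = β` lies in `L`.
    have hle : ∀ x ∈ IntermediateField.adjoin N₀ {r}, x ∈ N := by
      intro x hx
      induction hx using IntermediateField.adjoin_induction with
      | mem x hx => rw [hx]; exact ⟨hrL, by rw [hDr]; exact hβL⟩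
      | algebraMap x => exact ⟨x.2.1, by
        rw [show D (algebraMap N₀ K x) = 0 from x.2.2]; exact L.zero_mem⟩
      | add x y _ _ hx hy => exact N.add_mem hx hy
      | inv x _ hx => exact N.inv_mem hx
      | mul x y _ _ hx hy => exact N.mul_mem hx hy
    obtain ⟨q, hq0, hq⟩ := hβalg
    let f : IntermediateField.adjoin N₀ {r} →+* N :=
      { toFun := fun x => ⟨x, hle x x.2⟩
        map_one' := rfl
        map_zero' := rfl
        map_add' := fun _ _ => rfl
        map_mul' := fun _ _ => rfl }
    refine ⟨q.map f, (Polynomial.map_ne_zero_iff f.injective).2 hq0, ?_⟩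
    rw [aeval_def, eval₂_map]
    exact hq
  have hDβL : D β ∈ L := derivation_mem_of_isAlgebraic D N L (fun x hx => hx) hβL hβN
  rw [hDβ] at hDβL
  have := L.mul_mem hDβL (L.pow_mem hQL 3)
  rwa [div_mul_cancel₀ _ (pow_ne_zero _ hιQ)] at this

/-- If a domain carries independent derivations forming an `sl₂`-triple with locally nilpotent `E`
and `F`, its field of fractions is generated by the kernels of `E` and `F`. -/
theorem fractionClosure_eq_top_of_slTriple (hE : LocallyNilpotent E) (hF : LocallyNilpotent F)
    (hFE : ∀ a, F (E a) = E (F a) - H a)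
    (hHE : ∀ a, H (E a) = E (H a) + 2 * E a) (hHF : ∀ a, H (F a) = F (H a) - 2 * F a)
    (hind : ∀ α β γ : A, (∀ a, α * E a + β * F a + γ * H a = 0) → α = 0 ∧ β = 0 ∧ γ = 0)
    (S : Subalgebra ℂ A) (hSE : ∀ a, E a = 0 → a ∈ S) (hSF : ∀ a, F a = 0 → a ∈ S) (a : A) :
    a ∈ fractionClosure S := by
  obtain ⟨P, Q, k, hFP, hFQ, hHP, hHQ, hw0⟩ := exists_weight_vectors hE hF hFE hHE hHF hind
  set w := Q * E P - P * E Q with hw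
  have hQ0 : Q ≠ 0 := by
    rintro hQ
    rw [hQ] at hw
    simp at hw
    exact hw0 hw
  -- This needs `P` and `Q` to have equal weight: the two terms `Q * H P` and `P * H Q` cancel.
  have hFw : F w = 0 := by
    rw [hw]
    simp only [map_sub, F.leibniz, hFE, hFP, hFQ, hHP, hHQ, smul_eq_mul, map_zero]
    ring
  have hHw : H w = (2 - 2 * k) * w := by
    rw [hw]
    simp only [map_sub, H.leibniz, hHE, hHP, hHQ, E.leibniz, smul_eq_mul, map_neg, E.map_natCast]
    ring
  set z := Q * E w - 2 * (w * E Q) with hz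
  have hFz : F z = -2 * (w * Q) := by
    have h2 : F (2 : A) = 0 := by exact_mod_cast F.map_natCast 2
    rw [hz]
    simp only [map_sub, F.leibniz, hFE, hFw, hFQ, hHw, hHQ, smul_eq_mul, map_zero, h2]
    ring
  have h20 : (2 : A) ≠ 0 := by
    have : CharZero A := charZero_of_injective_algebraMap (algebraMap ℂ A).injective
    exact two_ne_zero
  have hFz0 : F z ≠ 0 := by
    rw [hFz]
    exact mul_ne_zero (neg_ne_zero.2 h20) (mul_ne_zero hw0 hQ0)
  have hFFz : F (F z) = 0 := by
    have h2 : F (-2 : A) = 0 := by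
      rw [map_neg, neg_eq_zero]; exact_mod_cast F.map_natCast 2
    rw [hFz, F.leibniz, F.leibniz, hFw, hFQ, h2]; simp
  suffices hzS : z ∈ fractionClosure S by
    obtain ⟨N, hN⟩ := exists_pow_mul_mem_of_slice F hF (fractionClosure S)
      (fun a ha => ⟨1, S.one_mem, one_ne_zero, by rw [one_mul]; exact hSF a ha⟩) hzS hFFz a
    obtain ⟨d, hd, hd0, h⟩ := hN
    have hFzS := S.pow_mem (hSF _ hFFz) N
    exact ⟨d * F z ^ N, S.mul_mem hd hFzS, mul_ne_zero hd0 (pow_ne_zero _ hFz0), by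
      rwa [mul_assoc]⟩
  refine wronskian_mem_fractionClosure (FractionRing A) hE hw hw0 hQ0 hFP hFQ hFw ?_ S hSE hSF
  by_contra h
  push Not at h
  exact one_ne_zero (hind 1 0 0 fun a => by simp [h a]).1

end SlTriple

end UnivariatePolynomials

/-! ### Krull dimension and derivations of polynomial rings -/

section MultivariatePolynomials

open MvPolynomial

theorem ringKrullDim_le_of_isIntegral {R S : Type*} [CommRing R] [CommRing S] (f : R →+* S)
    (hf : f.IsIntegral) : ringKrullDim S ≤ ringKrullDim R := by
  algebraize [f]
  refine Order.krullDim_le_of_strictMono (PrimeSpectrum.comap f) fun I J h => ?_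
  exact Ideal.IsIntegral.comap_lt_comap (R := R) (I := I.asIdeal) (J := J.asIdeal) h

/-- A derivation of a polynomial ring in `n` variables vanishing on an algebra of Krull dimension
at least `n` is zero. -/
theorem derivation_eq_zero_of_le_ringKrullDim {R : Type*} [CommRing R] [Algebra ℂ R] [Nontrivial R]
    [Algebra.FiniteType ℂ R] {n : ℕ} (hR : (n : WithBot ℕ∞) ≤ ringKrullDim R)
    (Ψ : R →ₐ[ℂ] MvPolynomial (Fin n) ℂ) (hΨ : Function.Injective Ψ)
    (W : Derivation ℂ (MvPolynomial (Fin n) ℂ) (MvPolynomial (Fin n) ℂ))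
    (hW : ∀ a, W (Ψ a) = 0) (b : MvPolynomial (Fin n) ℂ) : W b = 0 := by
  -- Noether normalization gives at least `n` algebraically independent elements of the image of
  -- `Ψ`. They form a transcendence basis, so every polynomial is algebraic over constants of `W`.
  obtain ⟨s, g, hg, hint⟩ := exists_integral_inj_algHom_of_fg ℂ R
  have hs : n ≤ s := by
    have := hR.trans (ringKrullDim_le_of_isIntegral g.toRingHom hint)
    rw [MvPolynomial.ringKrullDim_of_isNoetherianRing, ringKrullDim_eq_zero_of_field, zero_add,
      Nat.card_eq_fintype_card, Fintype.card_fin] at this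
    exact_mod_cast this
  let y : Fin s → MvPolynomial (Fin n) ℂ := fun i => Ψ (g (X i))
  have hy : AlgebraicIndependent ℂ y := by
    have := (algebraicIndependent_X (Fin s) ℂ).map' (f := Ψ.comp g) (hΨ.comp hg)
    exact this
  have hb : IsTranscendenceBasis ℂ y := by
    refine hy.isTranscendenceBasis_of_lift_trdeg_le_of_finite ?_
    rw [MvPolynomial.trdeg_of_isDomain]
    simpa using hs
  have key : ∀ (K : Type) [Field K] [Algebra (MvPolynomial (Fin n) ℂ) K]
      [IsFractionRing (MvPolynomial (Fin n) ℂ) K], W b = 0 := by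
    intro K _ _ _
    have hinj := IsFractionRing.injective (MvPolynomial (Fin n) ℂ) K
    have : CharZero K := charZero_of_injective_algebraMap hinj
    obtain ⟨D, hD⟩ := exists_derivation_fractionRing (K := K) W
    let N : Subfield K :=
      { carrier := {x | D x = 0}
        mul_mem' := fun {x y} (hx : D x = 0) (hy : D y = 0) =>
          show D (x * y) = 0 by rw [D.leibniz, hx, hy]; simp
        one_mem' := D.map_one_eq_zero
        add_mem' := fun {x y} (hx : D x = 0) (hy : D y = 0) =>
          show D (x + y) = 0 by rw [map_add, hx, hy, add_zero]
        zero_mem' := map_zero D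
        neg_mem' := fun {x} (hx : D x = 0) => show D (-x) = 0 by rw [map_neg, hx, neg_zero]
        inv_mem' := fun x (hx : D x = 0) => show D x⁻¹ = 0 by rw [D.leibniz_inv, hx]; simp }
    by_contra hne
    refine not_isAlgebraic_of_derivation_ne_zero D N (fun x hx => hx)
      (x := algebraMap _ K b) (by rwa [hD, Ne, map_eq_zero_iff _ hinj]) ?_
    obtain ⟨q, hq0, hq⟩ := hb.isAlgebraic.isAlgebraic b
    have hC : ∀ c ∈ Algebra.adjoin ℂ (Set.range y), W c = 0 := by
      intro c hc
      induction hc using Algebra.adjoin_induction with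
      | mem x hx => obtain ⟨i, rfl⟩ := hx; exact hW _
      | algebraMap c => exact W.map_algebraMap c
      | add x y _ _ hx hy => rw [map_add, hx, hy, add_zero]
      | mul x y _ _ hx hy => rw [W.leibniz, hx, hy]; simp
    let f : Algebra.adjoin ℂ (Set.range y) →+* N :=
      { toFun := fun c => ⟨algebraMap (MvPolynomial (Fin n) ℂ) K c, by
          change D _ = 0
          rw [hD, hC c c.2, map_zero]⟩
        map_one' := Subtype.ext (by simp)
        map_zero' := Subtype.ext (by simp)
        map_add' := fun _ _ => Subtype.ext (by simp)
        map_mul' := fun _ _ => Subtype.ext (by simp) }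
    have hf : Function.Injective f := fun a b h => Subtype.ext (hinj (congrArg Subtype.val h))
    refine ⟨q.map f, (Polynomial.map_ne_zero_iff hf).2 hq0, ?_⟩
    rw [Polynomial.aeval_def, Polynomial.eval₂_map]
    have h2 := Polynomial.hom_eval₂ q (algebraMap (Algebra.adjoin ℂ (Set.range y)) _)
      (algebraMap (MvPolynomial (Fin n) ℂ) K) b
    rw [← Polynomial.aeval_def, hq, map_zero] at h2
    exact h2.symm
  exact key (FractionRing (MvPolynomial (Fin n) ℂ))

/-! ### A polynomial chart of `SL₂` -/

section Chart

/-- The traceless matrix with given entries as the generator of a curve in `SL₂`. -/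
noncomputable def curve (p q r t : ℂ) : SL2 :=
  ⟨!![(1 + q * r * t ^ 2) * Complex.exp (p * t), q * t * Complex.exp (-(p * t));
      r * t * Complex.exp (p * t), Complex.exp (-(p * t))], by
    have h : Complex.exp (p * t) * Complex.exp (-(p * t)) = 1 := by
      rw [← Complex.exp_add, add_neg_cancel, Complex.exp_zero]
    rw [Matrix.det_fin_two_of]
    linear_combination h⟩

/-- A polynomial map onto the matrices in `SL₂` with nonzero lower left entry. -/
def chart (u v w : ℂ) : SL2 :=
  ⟨!![1 + u * v, u + w * (1 + u * v); v, 1 + v * w], by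
    rw [Matrix.det_fin_two_of]; ring⟩

/-- The vector field on the source of `chart` that is `v` times the vector field on `SL₂` generated
by left multiplication with the curve through `!![p, q; r, -p]`. -/
noncomputable def chartField (p q r : ℂ) :
    Derivation ℂ (MvPolynomial (Fin 3) ℂ) (MvPolynomial (Fin 3) ℂ) :=
  mkDerivation ℂ ![
    (C p * (1 + X 0 * X 1) + C q * X 1) - X 0 * (C r * (1 + X 0 * X 1) - C p * X 1),
    X 1 * (C r * (1 + X 0 * X 1) - C p * X 1),
    (C r * (X 0 + X 2 * (1 + X 0 * X 1)) - C p * (1 + X 1 * X 2)) -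
      X 2 * (C r * (1 + X 0 * X 1) - C p * X 1)]

theorem curve_zero (p q r : ℂ) : curve p q r 0 = 1 := by
  ext i j
  fin_cases i <;> fin_cases j <;> simp [curve]

theorem hasDerivAt_curve (p q r : ℂ) (i j : Fin 2) :
    HasDerivAt (fun t => (curve p q r t : Matrix (Fin 2) (Fin 2) ℂ) i j)
      (!![p, q; r, -p] i j) 0 := by
  have h1 : HasDerivAt (fun t : ℂ => Complex.exp (p * t)) p 0 := by
    have := ((hasDerivAt_id (0 : ℂ)).const_mul p).cexp
    simpa using this
  have h2 : HasDerivAt (fun t : ℂ => Complex.exp (-(p * t))) (-p) 0 := by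
    have := ((hasDerivAt_id (0 : ℂ)).const_mul p).neg.cexp
    simpa using this
  have h3 : ∀ c : ℂ, HasDerivAt (fun t : ℂ => c * t) c 0 := fun c => by
    simpa using (hasDerivAt_id (0 : ℂ)).const_mul c
  have h4 : HasDerivAt (fun t : ℂ => 1 + q * r * t ^ 2) 0 0 := by
    have := (((hasDerivAt_id (0 : ℂ)).pow 2).const_mul (q * r)).const_add 1
    simpa using this
  fin_cases i <;> fin_cases j
  · simpa [curve] using h4.fun_mul h1
  · simpa [curve] using (h3 q).fun_mul h2
  · simpa [curve] using (h3 r).fun_mul h1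
  · simpa [curve] using h2

/-- Both properties pass to sums and products by the Leibniz rule, so only matrix entries need
checking. The factor `v` removes the pole of the vector field in the chart. -/
theorem exists_chart_polynomial (p q r : ℂ) {f : SL2 → ℂ}
    (hf : f ∈ RegularFunctions.coordRing (G := SL2)) :
    ∃ R : MvPolynomial (Fin 3) ℂ, ∀ u v w : ℂ, f (chart u v w) = eval ![u, v, w] R ∧
      ∃ l, HasDerivAt (fun t => f (curve p q r t * chart u v w)) l 0 ∧
        v * l = eval ![u, v, w] (chartField p q r R) := by
  induction hf using Algebra.adjoin_induction with
  | mem x hx =>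
    obtain ⟨⟨i, j⟩, rfl⟩ := hx
    refine ⟨(!![1 + X 0 * X 1, X 0 + X 2 * (1 + X 0 * X 1); X 1, 1 + X 1 * X 2] :
      Matrix (Fin 2) (Fin 2) (MvPolynomial (Fin 3) ℂ)) i j, fun u v w => ⟨?_, ?_⟩⟩
    · fin_cases i <;> fin_cases j <;> simp [chart]
    · have hd : HasDerivAt (fun t => ∑ k, (curve p q r t : Matrix (Fin 2) (Fin 2) ℂ) i k *
          (chart u v w : Matrix (Fin 2) (Fin 2) ℂ) k j) _ 0 :=
        HasDerivAt.fun_sum fun k _ => (hasDerivAt_curve p q r i k).mul_const _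
      refine ⟨_, by simpa only [Matrix.SpecialLinearGroup.coe_mul, Matrix.mul_apply] using hd, ?_⟩
      fin_cases i <;> fin_cases j <;>
        simp [chart, chartField, Derivation.leibniz, mkDerivation_X, Fin.sum_univ_two,
          -mul_eq_mul_left_iff] <;> ring
  | algebraMap c =>
    exact ⟨C c, fun u v w => ⟨by simp, 0, hasDerivAt_const _ _, by simp⟩⟩
  | add x y _ _ hx hy =>
    obtain ⟨R, hR⟩ := hx
    obtain ⟨S, hS⟩ := hy
    refine ⟨R + S, fun u v w => ⟨by simp [(hR u v w).1, (hS u v w).1], ?_⟩⟩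
    obtain ⟨l, hl, hl'⟩ := (hR u v w).2
    obtain ⟨m, hm, hm'⟩ := (hS u v w).2
    exact ⟨l + m, hl.add hm, by rw [map_add, map_add, ← hl', ← hm']; ring⟩
  | mul x y _ _ hx hy =>
    obtain ⟨R, hR⟩ := hx
    obtain ⟨S, hS⟩ := hy
    refine ⟨R * S, fun u v w => ⟨by simp [(hR u v w).1, (hS u v w).1], ?_⟩⟩
    obtain ⟨l, hl, hl'⟩ := (hR u v w).2
    obtain ⟨m, hm, hm'⟩ := (hS u v w).2
    refine ⟨_, hl.mul hm, ?_⟩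
    rw [Derivation.leibniz, map_add, smul_eq_mul, smul_eq_mul, map_mul, map_mul, ← hl', ← hm',
      curve_zero, one_mul, (hR u v w).1, (hS u v w).1]
    ring

theorem eq_zero_of_chart_eq_zero {f : SL2 → ℂ} (hf : f ∈ RegularFunctions.coordRing (G := SL2))
    (h : ∀ u v w, f (chart u v w) = 0) (g : SL2) : f g = 0 := by
  have h1 : ∀ g : SL2, (g : Matrix (Fin 2) (Fin 2) ℂ) 1 0 ≠ 0 → f g = 0 := by
    intro g hg
    have hdet := g.2
    rw [Matrix.det_fin_two] at hdet
    have : g = chart ((g.1 0 0 - 1) / g.1 1 0) (g.1 1 0) ((g.1 1 1 - 1) / g.1 1 0) := by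
      ext i j
      fin_cases i <;> fin_cases j <;> simp [chart] <;> field_simp
      · ring
      · linear_combination -hdet
      · ring
    rw [this, h]
  by_cases hg : (g : Matrix (Fin 2) (Fin 2) ℂ) 1 0 = 0
  swap
  · exact h1 g hg
  -- Right multiplication by `L s` with `s ≠ 0` moves `g` into the image of the chart; continuity at
  -- `s = 0` then concludes.
  let L : ℂ → SL2 := fun s => ⟨!![1, 0; s, 1], by rw [Matrix.det_fin_two_of]; ring⟩
  have hcont : Continuous fun s => f (g * L s) := by
    clear h h1
    induction hf using Algebra.adjoin_induction with
    | mem x hx =>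
      obtain ⟨⟨i, j⟩, rfl⟩ := hx
      simp only [Matrix.SpecialLinearGroup.coe_mul, Matrix.mul_apply, Fin.sum_univ_two]
      fin_cases j <;> simp [L] <;> fun_prop
    | algebraMap c => exact continuous_const
    | add x y _ _ hx hy => exact hx.add hy
    | mul x y _ _ hx hy => exact hx.mul hy
  have hd : (g : Matrix (Fin 2) (Fin 2) ℂ) 1 1 ≠ 0 := by
    intro hd
    have hdet := g.2
    rw [Matrix.det_fin_two, hg, hd] at hdet
    simp at hdet
  have hzero : (fun s => f (g * L s)) = fun _ => 0 := by
    refine hcont.ext_on (dense_compl_singleton (0 : ℂ)) continuous_const fun s hs => h1 _ ?_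
    simp only [Matrix.SpecialLinearGroup.coe_mul, Matrix.mul_apply, Fin.sum_univ_two]
    simpa [L, hg] using ⟨hd, hs⟩
  have := congrFun hzero 0
  have hL : L 0 = 1 := by
    ext i j
    fin_cases i <;> fin_cases j <;> simp [L]
  simpa [hL] using this

end Chart

/-! ### Orbit dimension and independence of vector fields -/

section Orbits

variable {A : Type*} [CommRing A] [Algebra ℂ A]

theorem pt_comp_action_mem_coordRing {G : Type} [Group G] [RegularFunctions G]
    (ρ : AlgAction G A) (x : Pt A) (f : A) :
    (fun g => x (ρ.hom g f)) ∈ RegularFunctions.coordRing (G := G) := by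
  obtain ⟨n, r, a, hr, h⟩ := ρ.algebraic f
  have : (fun g => x (ρ.hom g f)) = ∑ i, x (a i) • r i := by
    ext g
    rw [h, map_sum, Finset.sum_apply]
    refine Finset.sum_congr rfl fun i _ => ?_
    rw [map_smul, Pi.smul_apply, smul_eq_mul, smul_eq_mul, mul_comm]
  rw [this]
  exact Subalgebra.sum_mem _ fun i _ => Subalgebra.smul_mem _ (hr i) _

theorem mem_vanishing_orbit {G : Type} [Group G] [RegularFunctions G] (ρ : AlgAction G A)
    (x : Pt A) (f : A) : f ∈ vanishing (orbit ρ x) ↔ ∀ g, x (ρ.hom g f) = 0 := by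
  simp only [vanishing, Submodule.mem_iInf, RingHom.mem_ker]
  constructor
  · intro h g
    have := h _ ⟨g⁻¹, rfl⟩
    simpa using this
  · rintro h _ ⟨g, rfl⟩
    exact h g⁻¹

theorem eq_of_traceless (e : LieSL2) : (e : Matrix (Fin 2) (Fin 2) ℂ) =
    !![e.1 0 0, e.1 0 1; e.1 1 0, -e.1 0 0] := by
  have htr : Matrix.trace (e : Matrix (Fin 2) (Fin 2) ℂ) = 0 := e.2
  rw [Matrix.trace_fin_two] at htr
  ext i j
  fin_cases i <;> fin_cases j <;> simp
  linear_combination htr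

theorem hasDerivAt_curve_of_traceless (e : LieSL2) (i j : Fin 2) :
    HasDerivAt (fun t => (curve (e.1 0 0) (e.1 0 1) (e.1 1 0) t : Matrix (Fin 2) (Fin 2) ℂ) i j)
      (e.1 i j) 0 := by
  have := hasDerivAt_curve (e.1 0 0) (e.1 0 1) (e.1 1 0) i j
  rwa [← eq_of_traceless] at this

theorem mvPolynomial_eq_of_eval_eq {P Q : MvPolynomial (Fin 3) ℂ}
    (h : ∀ u v w, eval ![u, v, w] P = eval ![u, v, w] Q) : P = Q := by
  refine MvPolynomial.funext fun x => ?_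
  have : x = ![x 0, x 1, x 2] := by
    ext i
    fin_cases i <;> rfl
  rw [this, h]

theorem chartField_ne_zero {p q r : ℂ} (h : ∀ b, chartField p q r b = 0) :
    p = 0 ∧ q = 0 ∧ r = 0 := by
  have h0 := h (X 0)
  have h1 := h (X 1)
  rw [chartField, mkDerivation_X] at h0 h1
  have e1 := congrArg (eval ![0, 1, 0]) h1
  have e2 := congrArg (eval ![0, 2, 0]) h1
  have e3 := congrArg (eval ![0, 1, 0]) h0
  simp at e1 e2 e3
  have hp : p = 0 := by linear_combination e1 - e2
  have hr : r = 0 := by linear_combination 2 * e1 - e2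
  exact ⟨hp, by rw [hp] at e3; linear_combination e3, hr⟩

/-- The orbit of a point at which a nonzero generating vector field vanishes is not
three-dimensional. -/
theorem dimension_orbit_ne_three [Algebra.FiniteType ℂ A] (ρ : AlgAction SL2 A) (x : Pt A)
    {e : LieSL2} (he : e ≠ 0) {δ : Derivation ℂ A A} (hδ : IsDifferentialAt ρ e δ)
    (hx : ∀ f, x (δ f) = 0) : dimension (orbit ρ x) ≠ 3 := by
  intro hdim
  choose R hR using fun f => exists_chart_polynomial (e.1 0 0) (e.1 0 1) (e.1 1 0)
    (pt_comp_action_mem_coordRing ρ x f)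
  have hRe : ∀ f u v w, eval ![u, v, w] (R f) = x (ρ.hom (chart u v w) f) :=
    fun f u v w => ((hR f u v w).1).symm
  let Ψ : A →ₐ[ℂ] MvPolynomial (Fin 3) ℂ :=
    { toFun := R
      map_one' := mvPolynomial_eq_of_eval_eq fun u v w => by simp [hRe]
      map_zero' := mvPolynomial_eq_of_eval_eq fun u v w => by simp [hRe]
      map_add' := fun f g => mvPolynomial_eq_of_eval_eq fun u v w => by simp [hRe]
      map_mul' := fun f g => mvPolynomial_eq_of_eval_eq fun u v w => by simp [hRe]
      commutes' := fun c => mvPolynomial_eq_of_eval_eq fun u v w => by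
        rw [hRe, AlgEquiv.commutes, AlgHom.commutes, algebraMap_eq, eval_C]; rfl }
  -- By the homomorphism property `l` is the derivative at `x` of `ρ.hom (chart u v w) f` along `δ`,
  -- which vanishes by `hx`.
  have hW : ∀ f, chartField (e.1 0 0) (e.1 0 1) (e.1 1 0) (R f) = 0 := by
    refine fun f => mvPolynomial_eq_of_eval_eq fun u v w => ?_
    obtain ⟨l, hl, hl'⟩ := (hR f u v w).2
    have h2 := hδ _ (curve_zero _ _ _) (hasDerivAt_curve_of_traceless e) x
      (ρ.hom (chart u v w) f)
    rw [hx] at h2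
    have : l = 0 := hl.unique (by
      simpa only [map_mul, AlgEquiv.mul_apply] using h2)
    rw [← hl', this, mul_zero, map_zero]
  have hker : RingHom.ker Ψ ≤ vanishing (orbit ρ x) := by
    intro f hf
    have hf' : R f = 0 := hf
    rw [mem_vanishing_orbit]
    refine eq_zero_of_chart_eq_zero (pt_comp_action_mem_coordRing ρ x f) fun u v w => ?_
    rw [← hRe, hf', map_zero]
  have hle : ∀ f ∈ vanishing (orbit ρ x), Ψ f = 0 := by
    intro f hf
    rw [mem_vanishing_orbit] at hf
    exact mvPolynomial_eq_of_eval_eq fun u v w => by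
      rw [map_zero]; exact (hRe f u v w).trans (hf _)
  -- Functions on the orbit closure embed in polynomials in three variables, and `chartField` kills
  -- the image; dimension three would make `chartField` zero.
  let Ψ' := Ideal.Quotient.liftₐ (vanishing (orbit ρ x)) Ψ hle
  have hinj : Function.Injective Ψ' :=
    RingHom.lift_injective_of_ker_le_ideal _ hle hker
  have : Nontrivial (A ⧸ vanishing (orbit ρ x)) := Ψ'.toRingHom.domain_nontrivial
  have hzero := derivation_eq_zero_of_le_ringKrullDim (n := 3) (le_of_eq hdim.symm) Ψ' hinj
    (chartField (e.1 0 0) (e.1 0 1) (e.1 1 0)) (fun a => by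
      obtain ⟨f, rfl⟩ := Ideal.Quotient.mk_surjective a
      exact hW f)
  obtain ⟨h1, h2, h3⟩ := chartField_ne_zero hzero
  refine he (Subtype.ext ?_)
  rw [eq_of_traceless, h1, h2, h3]
  ext i j
  fin_cases i <;> fin_cases j <;> simp

/-- At a generic point `x` a relation yields the element `x α • e + x β • f + x γ • h` of `sl₂`,
whose field vanishes at `x`; it must be zero. Coefficients vanishing at all generic points vanish.
-/
theorem linearIndependent_of_genericOrbitDim [IsDomain A] [Algebra.FiniteType ℂ A]
    (ρ : AlgAction SL2 A) (hdim : GenericOrbitDim ρ 3) (δ : LieSL2 →ₗ[ℂ] Derivation ℂ A A)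
    (hδ : ∀ e, IsDifferentialAt ρ e (δ e)) {e f h : LieSL2}
    (hefh : ∀ a b c : ℂ, a • e + b • f + c • h = 0 → a = 0 ∧ b = 0 ∧ c = 0)
    (α β γ : A) (hrel : ∀ a, α * δ e a + β * δ f a + γ * δ h a = 0) :
    α = 0 ∧ β = 0 ∧ γ = 0 := by
  obtain ⟨d, hd0, hd⟩ := hdim
  have key : ∀ x : Pt A, x d ≠ 0 → x α = 0 ∧ x β = 0 ∧ x γ = 0 := by
    intro x hxd
    refine hefh _ _ _ ?_
    by_contra hne
    refine dimension_orbit_ne_three ρ x hne (hδ _) (fun a => ?_) (hd x hxd)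
    rw [map_add, map_add, map_smul, map_smul, map_smul]
    have := congrArg x (hrel a)
    simpa using this
  have key' : ∀ y : A, (∀ x : Pt A, x d ≠ 0 → x y = 0) → y = 0 := by
    intro y hy
    by_contra hy0
    obtain ⟨x, hx⟩ := exists_pt_ne_zero (mul_ne_zero hd0 hy0)
    rw [map_mul] at hx
    exact right_ne_zero_of_mul hx (hy x (left_ne_zero_of_mul hx))
  exact ⟨key' _ fun x hx => (key x hx).1, key' _ fun x hx => (key x hx).2.1,
    key' _ fun x hx => (key x hx).2.2⟩

end Orbits

/-! ### The differential of an `SL₂`-action -/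

section Differential

variable {A A' : Type*} [CommRing A] [Algebra ℂ A] [CommRing A'] [Algebra ℂ A']

theorem exists_hasDerivAt_of_mem_coordRing {f : SL2 → ℂ}
    (hf : f ∈ RegularFunctions.coordRing (G := SL2)) {c : ℂ → SL2} {e : LieSL2}
    (hc : ∀ i j, HasDerivAt (fun t => (c t : Matrix (Fin 2) (Fin 2) ℂ) i j) (e.1 i j) 0) :
    ∃ l, HasDerivAt (fun t => f (c t)) l 0 := by
  induction hf using Algebra.adjoin_induction with
  | mem x hx =>
    obtain ⟨⟨i, j⟩, rfl⟩ := hx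
    exact ⟨_, hc i j⟩
  | algebraMap a => exact ⟨0, hasDerivAt_const _ _⟩
  | add x y _ _ hx hy =>
    obtain ⟨l, hl⟩ := hx
    obtain ⟨m, hm⟩ := hy
    exact ⟨_, hl.add hm⟩
  | mul x y _ _ hx hy =>
    obtain ⟨l, hl⟩ := hx
    obtain ⟨m, hm⟩ := hy
    exact ⟨_, hl.mul hm⟩

/-- Differentiating the expansion of `ρ'.hom g f` given by algebraicity produces an element of `A'`.
-/
theorem exists_differential_restrict [IsDomain A] [Algebra.FiniteType ℂ A] (p : A' →ₐ[ℂ] A)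
    (hp : Function.Injective p) (ρ : AlgAction SL2 A) (ρ' : AlgAction SL2 A')
    (h : ∀ g f, p (ρ'.hom g f) = ρ.hom g (p f)) {e : LieSL2} {δ : Derivation ℂ A A}
    (hδ : IsDifferentialAt ρ e δ) : ∃ δ' : Derivation ℂ A' A', ∀ a, p (δ' a) = δ (p a) := by
  refine exists_derivation_restrict p hp δ fun f => ?_
  obtain ⟨n, r, a, hr, hf⟩ := ρ'.algebraic f
  have hc := hasDerivAt_curve_of_traceless e
  choose l hl using fun i => exists_hasDerivAt_of_mem_coordRing (hr i) hc
  refine ⟨∑ i, l i • a i, eq_of_forall_pt fun x => ?_⟩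
  refine (hδ _ (curve_zero _ _ _) hc x (p f)).unique ?_
  have h2 : HasDerivAt (fun t => ∑ i, r i (curve (e.1 0 0) (e.1 0 1) (e.1 1 0) t) * x (p (a i)))
      (∑ i, l i * x (p (a i))) 0 := HasDerivAt.fun_sum fun i _ => (hl i).mul_const _
  simpa only [← h, hf, map_sum, map_smul, smul_eq_mul] using h2

theorem isDifferentialAt_restrict (p : A' →ₐ[ℂ] A)
    (hsurj : Function.Surjective fun x : Pt A => (x.comp p : Pt A'))
    (ρ : AlgAction SL2 A) (ρ' : AlgAction SL2 A')
    (h : ∀ g f, p (ρ'.hom g f) = ρ.hom g (p f)) {e : LieSL2} {δ : Derivation ℂ A A}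
    (hδ : IsDifferentialAt ρ e δ) {δ' : Derivation ℂ A' A'} (hδ' : ∀ a, p (δ' a) = δ (p a)) :
    IsDifferentialAt ρ' e δ' := by
  intro c hc0 hc x f
  obtain ⟨y, rfl⟩ := hsurj x
  have := hδ c hc0 hc y (p f)
  simpa only [AlgHom.comp_apply, h, hδ'] using this

theorem exp_eq_one_add_of_sq_eq_zero {x : Matrix (Fin 2) (Fin 2) ℂ} (hx : x * x = 0) :
    NormedSpace.exp x = 1 + x := by
  rw [NormedSpace.exp_eq_tsum ℂ]
  change ∑' n : ℕ, (n.factorial⁻¹ : ℂ) • x ^ n = _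
  rw [tsum_eq_sum (s := Finset.range 2)]
  · simp [Finset.sum_range_succ]
  · intro n hn
    obtain ⟨m, rfl⟩ : ∃ m, n = 2 + m := ⟨n - 2, by simp at hn; omega⟩
    rw [pow_add, pow_two, hx, zero_mul, smul_zero]

/-- Functions killed by the vector field of a nilpotent element are invariant under the
one-parameter subgroup. -/
theorem mem_invariants_oneParam [IsDomain A] [Algebra.FiniteType ℂ A] (ρ : AlgAction SL2 A)
    {e : LieSL2} (he : (e : Matrix (Fin 2) (Fin 2) ℂ) * e = 0) {δ : Derivation ℂ A A}
    (hδ : IsDifferentialAt ρ e δ) {f : A} (hf : δ f = 0) : f ∈ invariants ρ (oneParam e) := by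
  have hsq : ∀ t : ℂ, (t • (e : Matrix (Fin 2) (Fin 2) ℂ)) * (t • (e : Matrix _ _ ℂ)) = 0 :=
    fun t => by rw [smul_mul_smul_comm, he, smul_zero]
  have hdet : ∀ t : ℂ, (1 + t • (e : Matrix (Fin 2) (Fin 2) ℂ)).det = 1 := by
    intro t
    have h00 := congrFun (congrFun he 0) 0
    rw [Matrix.mul_apply, Fin.sum_univ_two] at h00
    rw [eq_of_traceless] at h00 ⊢
    simp at h00
    rw [Matrix.det_fin_two]
    simp
    linear_combination -t ^ 2 * h00
  -- Since `e` squares to zero, `exp (t e) = 1 + t e`. By the group law the derivative of `f` along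
  -- this subgroup vanishes at all times.
  let c : ℂ → SL2 := fun t => ⟨1 + t • (e : Matrix (Fin 2) (Fin 2) ℂ), hdet t⟩
  have hc0 : c 0 = 1 := by
    refine Subtype.ext ?_
    simp [c]
  have hcd : ∀ i j, HasDerivAt (fun t => (c t : Matrix (Fin 2) (Fin 2) ℂ) i j) (e.1 i j) 0 := by
    intro i j
    have := ((hasDerivAt_id (0 : ℂ)).mul_const (e.1 i j)).const_add
      ((1 : Matrix (Fin 2) (Fin 2) ℂ) i j)
    simpa [c] using this
  have hadd : ∀ s t, c (s + t) = c s * c t := by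
    intro s t
    refine Subtype.ext ?_
    change 1 + (s + t) • e.1 = (1 + s • e.1) * (1 + t • e.1)
    rw [add_mul, mul_add, mul_add, smul_mul_smul_comm, he, smul_zero, add_smul]
    simp [add_assoc, add_comm]
  rintro g ⟨t, ht⟩
  have hg : g = c t := Subtype.ext (by rw [ht, exp_eq_one_add_of_sq_eq_zero (hsq t)])
  refine eq_of_forall_pt fun x => ?_
  have hder : ∀ s, HasDerivAt (fun s => x (ρ.hom (c s) f)) 0 s := by
    intro s
    have h1 := hδ c hc0 hcd (x.comp (ρ.hom (c s) : A →ₐ[ℂ] A)) f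
    rw [hf, map_zero] at h1
    have h2 : HasDerivAt (fun t => x (ρ.hom (c (s + t)) f)) 0 (s - s) := by
      rw [sub_self]
      simp only [hadd, map_mul, AlgEquiv.mul_apply]
      exact h1
    have h3 := HasDerivAt.comp_sub_const s s h2
    simpa using h3
  have hconst := is_const_of_deriv_eq_zero (fun s => (hder s).differentiableAt)
    (fun s => (hder s).deriv) t 0
  rw [hg, hconst, hc0, map_one]
  rfl

end Differential

end MultivariatePolynomials

/-! ### Algebra of `sl₂` -/

section TracelessMatrices

/-- The bilinear form `trace (x y)` on traceless matrices. -/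
def traceProd (x y : LieSL2) : ℂ :=
  2 * x.1 0 0 * y.1 0 0 + x.1 0 1 * y.1 1 0 + x.1 1 0 * y.1 0 1

/-- By Cayley–Hamilton `x y + y x` is the scalar `trace (x y)`, and in particular `x * x` is half of
`trace (x x)`. -/
theorem lie_lie_self (x y : LieSL2) :
    ⁅⁅x, y⁆, x⁆ = (2 * traceProd x y) • x - (2 * traceProd x x) • y := by
  refine Subtype.ext ?_
  change ⁅⁅x.1, y.1⁆, x.1⁆ = (2 * traceProd x y) • x.1 - (2 * traceProd x x) • y.1
  rw [Ring.lie_def, Ring.lie_def]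
  ext i j
  simp only [traceProd]
  rw [eq_of_traceless x, eq_of_traceless y]
  fin_cases i <;> fin_cases j <;> simp <;> ring

theorem mul_self_of_traceProd_eq_zero {x : LieSL2} (h : traceProd x x = 0) :
    (x : Matrix (Fin 2) (Fin 2) ℂ) * x = 0 := by
  simp only [traceProd] at h
  have h' : x.1 0 0 * x.1 0 0 + x.1 0 1 * x.1 1 0 = 0 := by linear_combination h / 2
  rw [eq_of_traceless x]
  ext i j
  fin_cases i <;> fin_cases j <;> simp [Matrix.mul_apply, Fin.sum_univ_two]
  · linear_combination h'
  · ring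
  · ring
  · linear_combination h'

theorem traceProd_comm (x y : LieSL2) : traceProd x y = traceProd y x := by
  simp only [traceProd]; ring

theorem traceProd_smul (c : ℂ) (x y : LieSL2) : traceProd x (c • y) = c * traceProd x y := by
  have : ∀ i j, (c • y : LieSL2).1 i j = c * y.1 i j := fun i j => rfl
  simp only [traceProd, this]; ring

theorem eq_zero_of_forall_lie_eq_zero {x : LieSL2} (h : ∀ y : LieSL2, ⁅x, y⁆ = 0) : x = 0 := by
  let e : LieSL2 := ⟨!![0, 1; 0, 0],
    (by simp [Matrix.trace_fin_two] : Matrix.trace !![(0 : ℂ), 1; 0, 0] = 0)⟩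
  let f : LieSL2 := ⟨!![0, 0; 1, 0],
    (by simp [Matrix.trace_fin_two] : Matrix.trace !![(0 : ℂ), 0; 1, 0] = 0)⟩
  have he : x.1 * e.1 - e.1 * x.1 = 0 := congrArg Subtype.val (h e)
  have hf : x.1 * f.1 - f.1 * x.1 = 0 := congrArg Subtype.val (h f)
  have h1 := congrFun (congrFun he 0) 0
  have h2 := congrFun (congrFun he 0) 1
  have h3 := congrFun (congrFun hf 0) 0
  rw [eq_of_traceless x] at h1 h2 h3
  simp [e, f] at h1 h2 h3
  have h4 : x.1 0 0 = 0 := h2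
  refine Subtype.ext ?_
  rw [eq_of_traceless x, h4, h1, h3]
  ext i j
  fin_cases i <;> fin_cases j <;> simp

/-- The elements commuting with a given one. -/
def commutant (x : LieSL2) : LieSubalgebra ℂ LieSL2 where
  carrier := {y | ⁅x, y⁆ = 0}
  add_mem' {y z} (hy : ⁅x, y⁆ = 0) (hz : ⁅x, z⁆ = 0) := show ⁅x, y + z⁆ = 0 by
    rw [lie_add, hy, hz, add_zero]
  zero_mem' := lie_zero x
  smul_mem' c y (hy : ⁅x, y⁆ = 0) := show ⁅x, c • y⁆ = 0 by rw [lie_smul, hy, smul_zero]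
  lie_mem' {y z} (hy : ⁅x, y⁆ = 0) (hz : ⁅x, z⁆ = 0) := show ⁅x, ⁅y, z⁆⁆ = 0 by
    rw [leibniz_lie, hy, hz, zero_lie, lie_zero, add_zero]

variable {e₁ e₂ : LieSL2}

theorem eq_zero_of_lie_generators_eq_zero
    (hgen : ∀ T : LieSubalgebra ℂ LieSL2, e₁ ∈ T → e₂ ∈ T → T = ⊤) {x : LieSL2}
    (h₁ : ⁅x, e₁⁆ = 0) (h₂ : ⁅x, e₂⁆ = 0) : x = 0 := by
  have := hgen (commutant x) h₁ h₂
  refine eq_zero_of_forall_lie_eq_zero fun y => ?_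
  have hy : y ∈ commutant x := by rw [this]; trivial
  exact hy

theorem lie_generators_ne_zero
    (hgen : ∀ T : LieSubalgebra ℂ LieSL2, e₁ ∈ T → e₂ ∈ T → T = ⊤) : ⁅e₁, e₂⁆ ≠ 0 := by
  intro h
  have h1 : e₁ = 0 := eq_zero_of_lie_generators_eq_zero hgen (lie_self _) h
  have h2 : e₂ = 0 := eq_zero_of_lie_generators_eq_zero hgen (by rw [← lie_skew, h, neg_zero])
    (lie_self _)
  have hbot := hgen ⊥ (by rw [h1]; exact zero_mem _) (by rw [h2]; exact zero_mem _)
  have hne : (⟨!![0, 1; 0, 0],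
      (by simp [Matrix.trace_fin_two] : Matrix.trace !![(0 : ℂ), 1; 0, 0] = 0)⟩ : LieSL2) ∈
      (⊥ : LieSubalgebra ℂ LieSL2) := by
    rw [hbot]; trivial
  rw [LieSubalgebra.mem_bot] at hne
  have := congrFun (congrFun (congrArg Subtype.val hne) 0) 1
  simp at this

/-- Otherwise `⁅e₁, e₂⁆` would commute with both generators, hence be central and zero. -/
theorem traceProd_generators_ne_zero
    (hgen : ∀ T : LieSubalgebra ℂ LieSL2, e₁ ∈ T → e₂ ∈ T → T = ⊤)
    (h₁ : traceProd e₁ e₁ = 0) (h₂ : traceProd e₂ e₂ = 0) : traceProd e₁ e₂ ≠ 0 := by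
  intro h
  refine lie_generators_ne_zero hgen (eq_zero_of_lie_generators_eq_zero hgen ?_ ?_)
  · rw [lie_lie_self, h, h₁]; simp
  · rw [← lie_skew e₁ e₂, neg_lie, lie_lie_self, traceProd_comm, h, h₂]; simp

theorem iterate_lie (x y : LieSL2) (n : ℕ) :
    (fun z => ⁅x, z⁆)^[2 * n + 1] y = (2 * traceProd x x) ^ n • ⁅x, y⁆ := by
  induction n with
  | zero => simp
  | succ n ih =>
    rw [show 2 * (n + 1) + 1 = (2 * n + 1) + 1 + 1 by ring, Function.iterate_succ_apply',
      Function.iterate_succ_apply', ih, lie_smul, lie_smul]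
    have : ⁅x, ⁅x, ⁅x, y⁆⁆⁆ = (2 * traceProd x x) • ⁅x, y⁆ := by
      rw [← lie_skew x ⁅x, y⁆, lie_lie_self, neg_sub, lie_sub, lie_smul, lie_smul, lie_self,
        smul_zero, sub_zero]
    rw [this, smul_smul, pow_succ]

theorem slTriple_independent {e f h : LieSL2} (hHe : ⁅h, e⁆ = (2 : ℂ) • e)
    (hHf : ⁅h, f⁆ = (-2 : ℂ) • f) (he0 : e ≠ 0) (hf0 : f ≠ 0) (hh0 : h ≠ 0) :
    ∀ a b c : ℂ, a • e + b • f + c • h = 0 → a = 0 ∧ b = 0 ∧ c = 0 := by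
  intro a b c habc
  have hlin : ∀ a b c : ℂ, ⁅h, a • e + b • f + c • h⁆ =
      (2 * a) • e + (-2 * b) • f + (0 : ℂ) • h := by
    intro a b c
    rw [lie_add, lie_add, lie_smul, lie_smul, lie_smul, hHe, hHf, lie_self, smul_smul, smul_smul]
    module
  have h1 := hlin a b c
  rw [habc, lie_zero] at h1
  have h2 := hlin (2 * a) (-2 * b) 0
  rw [← h1, lie_zero] at h2
  -- With `T = ad h`, the combinations `T / 4 + T² / 8` and `-T / 4 + T² / 8` project onto the
  -- eigenvalues `2` and `-2`.
  have ha : a • e = (1 / 4 : ℂ) • ((2 * a) • e + (-2 * b) • f + (0 : ℂ) • h) +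
      (1 / 8 : ℂ) • ((2 * (2 * a)) • e + (-2 * (-2 * b)) • f + (0 : ℂ) • h) := by module
  have hb : b • f = (-1 / 4 : ℂ) • ((2 * a) • e + (-2 * b) • f + (0 : ℂ) • h) +
      (1 / 8 : ℂ) • ((2 * (2 * a)) • e + (-2 * (-2 * b)) • f + (0 : ℂ) • h) := by module
  rw [← h1, ← h2, smul_zero, smul_zero, add_zero] at ha hb
  rw [ha, hb, zero_add, zero_add] at habc
  exact ⟨(smul_eq_zero.1 ha).resolve_right he0, (smul_eq_zero.1 hb).resolve_right hf0,
    (smul_eq_zero.1 habc).resolve_right hh0⟩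

end TracelessMatrices

/-! ### Ad-nilpotency of locally nilpotent derivations -/

section AdNilpotent

variable {A : Type*} [CommRing A] [Algebra ℂ A]

/-- Induction on the order of nilpotency at `a`: once the iterated brackets kill `D a`, each further
bracket merely applies `D` to the value at `a`. -/
theorem exists_iterate_lie_apply_eq_zero {D : Derivation ℂ A A} (hD : LocallyNilpotent D)
    (D' : Derivation ℂ A A) (a : A) :
    ∃ n₀, ∀ n ≥ n₀, ((fun X : Derivation ℂ A A => ⁅D, X⁆)^[n] D') a = 0 := by
  obtain ⟨N, hN⟩ := hD a
  induction N generalizing a with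
  | zero => exact ⟨0, fun n _ => by rw [show a = 0 from hN, map_zero]⟩
  | succ N ih =>
    obtain ⟨n₀, h₀⟩ := ih (D a) hN
    have hstep : ∀ m, ((fun X : Derivation ℂ A A => ⁅D, X⁆)^[n₀ + m] D') a =
        (⇑D)^[m] (((fun X : Derivation ℂ A A => ⁅D, X⁆)^[n₀] D') a) := by
      intro m
      induction m with
      | zero => rfl
      | succ m ihm =>
        rw [← add_assoc, Function.iterate_succ_apply', Derivation.commutator_apply, ihm,
          h₀ _ (by omega), sub_zero, Function.iterate_succ_apply']
    obtain ⟨M, hM⟩ := hD (((fun X : Derivation ℂ A A => ⁅D, X⁆)^[n₀] D') a)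
    refine ⟨n₀ + M, fun n hn => ?_⟩
    obtain ⟨k, rfl⟩ := Nat.exists_eq_add_of_le hn
    rw [add_assoc, hstep, add_comm M k, Function.iterate_add_apply, hM, iterate_map_zero]

/-- The adjoint action of a locally nilpotent derivation of a finitely generated algebra is locally
nilpotent. -/
theorem exists_iterate_lie_eq_zero [Algebra.FiniteType ℂ A] {D : Derivation ℂ A A}
    (hD : LocallyNilpotent D) (D' : Derivation ℂ A A) :
    ∃ n₀, ∀ n ≥ n₀, (fun X : Derivation ℂ A A => ⁅D, X⁆)^[n] D' = 0 := by
  obtain ⟨s, hs⟩ := Algebra.FiniteType.out (R := ℂ) (A := A)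
  choose n₀ h₀ using exists_iterate_lie_apply_eq_zero hD D'
  refine ⟨s.sup n₀, fun n hn => ?_⟩
  refine Derivation.ext_of_adjoin_eq_top (s : Set A) hs fun a ha => ?_
  rw [h₀ a n ((Finset.le_sup ha).trans hn)]
  rfl

end AdNilpotent

/-! ### The case of `SL₂` -/

section SL2Action

variable {A A' : Type*}
  [CommRing A] [Algebra ℂ A] [IsDomain A] [IsIntegrallyClosed A] [Algebra.FiniteType ℂ A]
  [CommRing A'] [Algebra ℂ A'] [IsDomain A'] [IsIntegrallyClosed A'] [Algebra.FiniteType ℂ A']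

/-- Odd powers of `ad x` on `y` are powers of `2 * traceProd x x` times `⁅x, y⁆`, while local
nilpotency makes high powers vanish. -/
theorem traceProd_self_eq_zero {B : Type*} [CommRing B] [Algebra ℂ B] [Algebra.FiniteType ℂ B]
    (ψ : LieSL2 →ₗ⁅ℂ⁆ Derivation ℂ B B) (hψ : Function.Injective ψ) {x y : LieSL2}
    (hx : LocallyNilpotent (ψ x)) (hxy : ⁅x, y⁆ ≠ 0) : traceProd x x = 0 := by
  obtain ⟨n, hn⟩ := exists_iterate_lie_eq_zero hx (ψ y)
  have hmap : ∀ m, ψ ((fun z => ⁅x, z⁆)^[m] y) =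
      (fun X : Derivation ℂ B B => ⁅ψ x, X⁆)^[m] (ψ y) := by
    intro m
    induction m with
    | zero => rfl
    | succ m ih => rw [Function.iterate_succ_apply', LieHom.map_lie, ih,
        Function.iterate_succ_apply']
  have h := (hmap (2 * n + 1)).trans (hn _ (by omega))
  rw [iterate_lie, map_eq_zero_iff ψ hψ, smul_eq_zero] at h
  exact (mul_eq_zero.1 (eq_zero_of_pow_eq_zero (h.resolve_right hxy))).resolve_left two_ne_zero

theorem LocallyNilpotent.smul {B : Type*} [CommRing B] [Algebra ℂ B] {D : Derivation ℂ B B}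
    (hD : LocallyNilpotent D) (c : ℂ) : LocallyNilpotent (c • D) := by
  intro f
  obtain ⟨n, hn⟩ := hD f
  refine ⟨n, ?_⟩
  have : ∀ m, (⇑(c • D))^[m] f = c ^ m • (⇑D)^[m] f := by
    intro m
    induction m with
    | zero => simp
    | succ m ih =>
      rw [Function.iterate_succ_apply', ih, Derivation.smul_apply, D.map_smul, smul_smul,
        Function.iterate_succ_apply', pow_succ']
  rw [this, hn, smul_zero]

theorem idealCondition_of_SL2 (p : A' →ₐ[ℂ] A) (hp : Function.Injective p) (hfin : p.Finite)
    (hsurj : Function.Surjective fun x : Pt A => (x.comp p : Pt A'))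
    (δ₁ δ₂ : Derivation ℂ A A) (ρ : AlgAction SL2 A)
    (φ : LieSL2 ≃ₗ⁅ℂ⁆ LieSubalgebra.lieSpan ℂ (Derivation ℂ A A) {δ₁, δ₂})
    (e₁ e₂ : LieSL2) (ρ' : AlgAction SL2 A')
    (hn₁ : LocallyNilpotent δ₁) (hn₂ : LocallyNilpotent δ₂)
    (hφ : ∀ e, IsDifferentialAt ρ e (φ e : Derivation ℂ A A))
    (h₁ : (φ e₁ : Derivation ℂ A A) = δ₁) (h₂ : (φ e₂ : Derivation ℂ A A) = δ₂)
    (hdim : GenericOrbitDim ρ' 3) (hequiv : ∀ g f, p (ρ'.hom g f) = ρ.hom g (p f))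
    (hI : IdealCondition (invariants ρ (oneParam e₁)) (invariants ρ (oneParam e₂))) :
    IdealCondition (invariants ρ' (oneParam e₁)) (invariants ρ' (oneParam e₂)) := by
  let L := LieSubalgebra.lieSpan ℂ (Derivation ℂ A A) {δ₁, δ₂}
  let ψ : LieSL2 →ₗ⁅ℂ⁆ Derivation ℂ A A := L.incl.comp φ.toLieHom
  have hψ : Function.Injective ψ := fun x y h => φ.injective (Subtype.ext h)
  have hψ₁ : ψ e₁ = δ₁ := h₁
  have hψ₂ : ψ e₂ = δ₂ := h₂
  have hψd : ∀ e, IsDifferentialAt ρ e (ψ e) := hφ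
  -- The injection `ψ` carries the generation of the span by `δ₁`, `δ₂` back to generation of `sl₂`
  -- by `e₁`, `e₂`.
  have hgen : ∀ T : LieSubalgebra ℂ LieSL2, e₁ ∈ T → e₂ ∈ T → T = ⊤ := by
    intro T hT₁ hT₂
    rw [eq_top_iff]
    intro z _
    have hle : L ≤ T.map ψ := by
      rw [LieSubalgebra.lieSpan_le]
      rintro _ (rfl | rfl)
      · exact ⟨e₁, hT₁, hψ₁⟩
      · exact ⟨e₂, hT₂, hψ₂⟩
    obtain ⟨z', hz', hzz'⟩ := hle (φ z).2
    have : z' = z := hψ hzz'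
    rwa [← this]
  have hne := lie_generators_ne_zero hgen
  have ht₁ : traceProd e₁ e₁ = 0 := traceProd_self_eq_zero ψ hψ (by rwa [hψ₁]) hne
  have ht₂ : traceProd e₂ e₂ = 0 := traceProd_self_eq_zero ψ hψ (x := e₂) (y := e₁)
    (by rwa [hψ₂]) (by rw [← lie_skew]; exact neg_ne_zero.2 hne)
  have hκ := traceProd_generators_ne_zero hgen ht₁ ht₂
  choose d hd using fun e => exists_differential_restrict p hp ρ ρ' hequiv (hψd e)
  let δ : LieSL2 →ₗ[ℂ] Derivation ℂ A' A' :=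
    { toFun := d
      map_add' := fun x y => Derivation.ext fun a => hp (by
        rw [hd, map_add, Derivation.add_apply, Derivation.add_apply, map_add, hd, hd])
      map_smul' := fun c x => Derivation.ext fun a => hp (by
        rw [hd, map_smul, Derivation.smul_apply, RingHom.id_apply, Derivation.smul_apply, map_smul,
          hd]) }
  have hδ : ∀ e a, p (δ e a) = ψ e (p a) := hd
  have hδlie : ∀ x y a, δ ⁅x, y⁆ a = δ x (δ y a) - δ y (δ x a) := fun x y a => hp (by
    rw [hδ, LieHom.map_lie, Derivation.commutator_apply, map_sub, hδ, hδ, hδ, hδ])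
  have hδd : ∀ e, IsDifferentialAt ρ' e (δ e) := fun e =>
    isDifferentialAt_restrict p hsurj ρ ρ' hequiv (hψd e) (hδ e)
  have hδn : ∀ e, LocallyNilpotent (ψ e) → LocallyNilpotent (δ e) := by
    intro e he a
    obtain ⟨n, hn⟩ := he (p a)
    refine ⟨n, hp ?_⟩
    have : ∀ m, p ((⇑(δ e))^[m] a) = (⇑(ψ e))^[m] (p a) := by
      intro m
      induction m with
      | zero => rfl
      | succ m ih => rw [Function.iterate_succ_apply', hδ, ih, Function.iterate_succ_apply']
    rw [this, hn, map_zero]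
  have hδ₁ : LocallyNilpotent (δ e₁) := hδn e₁ (by rwa [hψ₁])
  have hδ₂ : LocallyNilpotent (δ e₂) := hδn e₂ (by rwa [hψ₂])
  set κ := traceProd e₁ e₂ with hκ_def
  -- Rescaling `e₂` to `traceProd e₁ f = 1` makes `e₁`, `f`, `⁅e₁, f⁆` a standard `sl₂`-triple
  -- without changing the kernel of the field.
  let f : LieSL2 := κ⁻¹ • e₂
  have hδf : δ f = κ⁻¹ • δ e₂ := map_smul δ _ _
  have hBef : traceProd e₁ f = 1 := by rw [traceProd_smul]; exact inv_mul_cancel₀ hκ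
  have hBff : traceProd f f = 0 := by
    rw [traceProd_smul, traceProd_comm, traceProd_smul, ht₂, mul_zero, mul_zero]
  have hHe : ⁅⁅e₁, f⁆, e₁⁆ = (2 : ℂ) • e₁ := by
    rw [lie_lie_self, hBef, ht₁]; simp
  have hHf : ⁅⁅e₁, f⁆, f⁆ = (-2 : ℂ) • f := by
    rw [← lie_skew e₁ f, neg_lie, lie_lie_self, traceProd_comm f e₁, hBef, hBff]; simp
  have he0 : e₁ ≠ 0 := by
    intro h
    exact hne (by rw [h, zero_lie])
  have hf0 : f ≠ 0 := by
    intro h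
    refine hne ?_
    rw [(smul_eq_zero.1 h).resolve_left (inv_ne_zero hκ), lie_zero]
  have hh0 : ⁅e₁, f⁆ ≠ 0 := by
    intro h
    rw [h, zero_lie, eq_comm, smul_eq_zero] at hHe
    exact hHe.elim (by norm_num) he0
  have hindep : ∀ a b c : ℂ, a • e₁ + b • f + c • ⁅e₁, f⁆ = 0 → a = 0 ∧ b = 0 ∧ c = 0 :=
    slTriple_independent hHe hHf he0 hf0 hh0
  have hinv : ∀ (e : LieSL2) (b : A), b ∈ invariants ρ (oneParam e) ↔
      ∀ g : oneParam e, ρ.hom g b = b :=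
    fun e b => ⟨fun h g => h g g.2, fun h g hg => h ⟨g, hg⟩⟩
  have hinv' : ∀ (e : LieSL2) (b : A'), b ∈ invariants ρ' (oneParam e) ↔
      ∀ g : oneParam e, ρ'.hom g b = b :=
    fun e b => ⟨fun h g => h g g.2, fun h g hg => h ⟨g, hg⟩⟩
  refine idealCondition_of_fixed p hp hfin (fun g : oneParam e₁ => ρ.hom g)
    (fun g : oneParam e₁ => ρ'.hom g) (fun g a => (hequiv g a).symm)
    (fun g : oneParam e₂ => ρ.hom g) (fun g : oneParam e₂ => ρ'.hom g)
    (fun g a => (hequiv g a).symm)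
    (hinv e₁) (hinv e₂) (hinv' e₁) (hinv' e₂) ?_ hI
  refine fractionClosure_eq_top_of_slTriple (E := δ e₁) (F := δ f) (H := δ ⁅e₁, f⁆) hδ₁
    (by rw [hδf]; exact hδ₂.smul _) (fun a => by rw [hδlie]; ring) (fun a => ?_) (fun a => ?_)
    (linearIndependent_of_genericOrbitDim ρ' hdim δ hδd hindep) _ (fun a ha => ?_) (fun a ha => ?_)
  · have h := hδlie ⁅e₁, f⁆ e₁ a
    rw [hHe, map_smul, Derivation.smul_apply, Algebra.smul_def, map_ofNat] at h
    linear_combination -h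
  · have h := hδlie ⁅e₁, f⁆ f a
    rw [hHf, map_smul, Derivation.smul_apply, Algebra.smul_def, map_neg, map_ofNat] at h
    linear_combination -h
  · exact (le_sup_left : invariants ρ' (oneParam e₁) ≤ _ ⊔ _)
      (mem_invariants_oneParam ρ' (mul_self_of_traceProd_eq_zero ht₁) (hδd e₁) ha)
  · refine (le_sup_right : invariants ρ' (oneParam e₂) ≤ _ ⊔ _)
      (mem_invariants_oneParam ρ' (mul_self_of_traceProd_eq_zero ht₂) (hδd e₂) ?_)
    rw [hδf, Derivation.smul_apply, smul_eq_zero] at ha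
    exact ha.resolve_left (inv_ne_zero hκ)

end SL2Action

end AffineAction

open AffineAction in
theorem lemma3p6 {A A' : Type*}
    [CommRing A] [Algebra ℂ A] [IsDomain A] [IsIntegrallyClosed A] [Algebra.FiniteType ℂ A]
    [CommRing A'] [Algebra ℂ A'] [IsDomain A'] [IsIntegrallyClosed A'] [Algebra.FiniteType ℂ A']
    (p : A' →ₐ[ℂ] A) (hp_finite : p.Finite)
    (hp_surj : Function.Surjective fun x : Pt A => (x.comp p : Pt A')) :
    -- commuting fields, `Γ = ℂ₊ × ℂ₊`
    (∀ (ρ₁ : AlgAction Ga A) (ρ₂ : AlgAction Ga A) (δ₁ δ₂ : Derivation ℂ A A)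
      (ρ' : AlgAction (Ga × Ga) A'),
      ρ₁.hom ≠ 1 → ρ₂.hom ≠ 1 → Generates ρ₁ δ₁ → Generates ρ₂ δ₂ → ⁅δ₁, δ₂⁆ = 0 →
      GenericOrbitDim ρ' 2 →
      (∀ h f, p (ρ'.hom (h, 1) f) = ρ₁.hom h (p f)) →
      (∀ h f, p (ρ'.hom (1, h) f) = ρ₂.hom h (p f)) →
      IdealCondition (invariants ρ₁ ⊤) (invariants ρ₂ ⊤) →
      IdealCondition (invariants ρ' (Subgroup.prod ⊤ ⊥)) (invariants ρ' (Subgroup.prod ⊥ ⊤))) ∧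
    -- commuting fields, `Γ = ℂ₊ × ℂ^*`
    (∀ (ρ₁ : AlgAction Ga A) (ρ₂ : AlgAction Gm A) (δ₁ δ₂ : Derivation ℂ A A)
      (ρ' : AlgAction (Ga × Gm) A'),
      ρ₁.hom ≠ 1 → ρ₂.hom ≠ 1 → Generates ρ₁ δ₁ → Generates ρ₂ δ₂ → ⁅δ₁, δ₂⁆ = 0 →
      GenericOrbitDim ρ' 2 →
      (∀ h f, p (ρ'.hom (h, 1) f) = ρ₁.hom h (p f)) →
      (∀ h f, p (ρ'.hom (1, h) f) = ρ₂.hom h (p f)) →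
      IdealCondition (invariants ρ₁ ⊤) (invariants ρ₂ ⊤) →
      IdealCondition (invariants ρ' (Subgroup.prod ⊤ ⊥)) (invariants ρ' (Subgroup.prod ⊥ ⊤))) ∧
    -- locally nilpotent fields generating `sl₂`, `Γ = SL₂`
    (∀ (δ₁ δ₂ : Derivation ℂ A A) (ρ : AlgAction SL2 A)
      (φ : LieSL2 ≃ₗ⁅ℂ⁆ LieSubalgebra.lieSpan ℂ (Derivation ℂ A A) {δ₁, δ₂})
      (e₁ e₂ : LieSL2) (ρ' : AlgAction SL2 A'),
      LocallyNilpotent δ₁ → LocallyNilpotent δ₂ →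
      (∀ e, IsDifferentialAt ρ e (φ e : Derivation ℂ A A)) →
      (φ e₁ : Derivation ℂ A A) = δ₁ → (φ e₂ : Derivation ℂ A A) = δ₂ →
      GenericOrbitDim ρ' 3 →
      (∀ g f, p (ρ'.hom g f) = ρ.hom g (p f)) →
      IdealCondition (invariants ρ (oneParam e₁)) (invariants ρ (oneParam e₂)) →
      IdealCondition (invariants ρ' (oneParam e₁)) (invariants ρ' (oneParam e₂))) := by
  -- A function in the kernel vanishes at every point of `X'` that lifts to `X`, hence at all of
  -- them.
  have hp : Function.Injective p := by
    rw [injective_iff_map_eq_zero]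
    intro f hf
    by_contra hne
    obtain ⟨x', hx'⟩ := exists_pt_ne_zero hne
    obtain ⟨x, rfl⟩ := hp_surj x'
    exact hx' (by simp [hf])
  refine ⟨?_, ?_, ?_⟩
  · intro ρ₁ ρ₂ _ _ ρ' hρ₁ _ _ _ _ _ h₁ h₂ hI
    exact idealCondition_of_commuting p hp hp_finite ρ₁ ρ₂ ρ' hρ₁ h₁ h₂ hI
  · intro ρ₁ ρ₂ _ _ ρ' hρ₁ _ _ _ _ _ h₁ h₂ hI
    exact idealCondition_of_commuting p hp hp_finite ρ₁ ρ₂ ρ' hρ₁ h₁ h₂ hI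
  · intro δ₁ δ₂ ρ φ e₁ e₂ ρ' hn₁ hn₂ hφ h₁ h₂ hdim hequiv hI
    exact idealCondition_of_SL2 p hp hp_finite hp_surj δ₁ δ₂ ρ φ e₁ e₂ ρ' hn₁ hn₂ hφ h₁ h₂ hdim
      hequiv hI
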